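/- Let $(Z_t)_{t\in\mathbb Z}$ be i.i.d. real random variables with $\mathbb E Z_0=0$ and $\mathbb E Z_0^2=1$, and put $\mathcal F_t=\sigma(Z_k;\,k\le t)$. Let $((X_t,\sigma_t))_{t\in\mathbb Z}$ be a stationary EGARCH process with parameter $\theta_0=(\alpha_0,\beta_0,\gamma_0,\delta_0)^T\in\mathbb R^4$, that is, a strictly stationary process such that $\sigma_t>0$ is $\mathcal F_{t-1}$-measurable and, almost surely for every $t\in\mathbb Z$, $$X_t=\sigma_tZ_t,\qquad \log\sigma_t^2=\alpha_0+\beta_0\log\sigma_{t-1}^2+\gamma_0Z_{t-1}+\delta_0|Z_{t-1}| .$$ Assume that $0\le\beta_0<1$, $\delta_0\ge|\gamma_0|$, $(\gamma_0,\delta_0)\ne(0,0)$, and that the distribution of $Z_0$ is not concentrated at two points, i.e. $\mathbb P(Z_0\in\{a,b\})<1$ for all $a,b\in\mathbb R$ (not necessarily distinct). Let $K$ be a compact subset of $\Theta=\{(\alpha,\beta,\gamma,\delta)^T\in\mathbb R^4:\ 0\le\beta<1,\ \delta\ge|\gamma|\}$ with $\theta_0\in K$. Put $m=\inf_{\theta\in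 K}\alpha(1-\beta)^{-1}$, $$\lambda_0(\theta)=\max\bigl(\beta,\ 2^{-1}e^{-m/2}(\gamma X_0+\delta|X_0|)-\beta\bigr),\qquad \|\lambda_0\|_K=\sup_{\theta\in K}|\lambda_0(\theta)|,$$ and assume that $\mathbb E(\log\|\lambda_0\|_K)<0$, where $\log 0=-\infty$ and the expectation may equal $-\infty$. Fix an initial value $\varsigma_0^2>0$. For $\theta=(\alpha,\beta,\gamma,\delta)^T\in K$ define $\hat h_0(\theta)=\varsigma_0^2$, $$\log\hat h_{t+1}(\theta)=\alpha+\beta\log\hat h_t(\theta)+(\gamma X_t+\delta|X_t|)\,\hat h_t(\theta)^{-1/2},\quad t\ge0,\qquad \hat L_n(\theta)=-\frac12\sum_{t=1}^n\Bigl(\frac{X_t^2}{\hat h_t(\theta)}+\log\hat h_t(\theta)\Bigr).$$ Then $\hat L_n$ attains its maximum on $K$ for every $n$ and every realization, and the quasi-maximum-likelihood estimator is strongly consistent: for every sequence $(\hat\theta_n)_{n\ge1}$ such that, for each $n\ge1$, almost surely $\hat\theta_n\in K$ and $\hat L_n(\hat\theta_n)=\max_{\theta\in K}\hat L_n(\theta)$,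 one has $\hat\theta_n\to\theta_0$ almost surely as $n\to\infty$. -/

import Mathlib

open MeasureTheory ProbabilityTheory Filter Topology
open scoped ENNReal

namespace EGARCH

/-- Parameter vectors `θ = (α, β, γ, δ)ᵀ ∈ ℝ⁴`. -/
abbrev Param : Type := EuclideanSpace ℝ (Fin 4)

/-- The coordinate `α`. -/
abbrev Param.α (θ : Param) : ℝ := θ 0

/-- The coordinate `β`. -/
abbrev Param.β (θ : Param) : ℝ := θ 1

/-- The coordinate `γ`. -/
abbrev Param.γ (θ : Param) : ℝ := θ 2

/-- The coordinate `δ`. -/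
abbrev Param.δ (θ : Param) : ℝ := θ 3

/-- The parameter space `Θ = ℝ × [0, 1) × {(γ, δ) | δ ≥ |γ|}`. -/
def paramSpace : Set Param := {θ | 0 ≤ θ.β ∧ θ.β < 1 ∧ |θ.γ| ≤ θ.δ}

section Model

variable {Ω : Type*} [MeasurableSpace Ω]

/-- Strict stationarity of a two-sided sequence: for every `h` the laws of `(Y_{t+h})_t` and of
`(Y_t)_t` on the sequence space coincide. -/
def IsStationary {E : Type*} [MeasurableSpace E] (P : Measure Ω) (Y : ℤ → Ω → E) : Prop :=
  ∀ h : ℤ, IdentDistrib (fun ω (t : ℤ) => Y (t + h) ω) (fun ω (t : ℤ) => Y t ω) P P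

/-- The σ-field `𝓕_t = σ(Z_k ; k ≤ t)`. -/
abbrev past (Z : ℤ → Ω → ℝ) (t : ℤ) : MeasurableSpace Ω :=
  ⨆ k : {k : ℤ // k ≤ t}, MeasurableSpace.comap (Z k) inferInstance

/-- `((X_t, σ_t))_{t ∈ ℤ}` is a stationary EGARCH process with parameter `θ` and innovations
`(Z_t)`. -/
structure IsStationaryEGARCH (P : Measure Ω) (θ : Param) (Z X σ : ℤ → Ω → ℝ) : Prop where
  measurable_Z : ∀ t, Measurable (Z t)
  /-- The innovations are independent, ... -/
  indep : iIndepFun Z P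
  /-- ... identically distributed, ... -/
  identDistrib : ∀ t, IdentDistrib (Z t) (Z 0) P P
  /-- ... centred, with variance one. -/
  memLp : MemLp (Z 0) 2 P
  mean : ∫ ω, Z 0 ω ∂P = 0
  variance : ∫ ω, (Z 0 ω) ^ 2 ∂P = 1
  /-- The volatility `σ_t` is `𝓕_{t-1}`-measurable ... -/
  measurable_σ : ∀ t, Measurable[past Z (t - 1)] (σ t)
  /-- ... and positive. -/
  pos : ∀ t, ∀ᵐ ω ∂P, 0 < σ t ω
  /-- `log σ_t² = α + β log σ_{t-1}² + γ Z_{t-1} + δ |Z_{t-1}|`. -/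
  recursion : ∀ t, ∀ᵐ ω ∂P, Real.log (σ t ω ^ 2) =
    θ.α + θ.β * Real.log (σ (t - 1) ω ^ 2) + θ.γ * Z (t - 1) ω + θ.δ * |Z (t - 1) ω|
  measurable_X : ∀ t, Measurable (X t)
  /-- `X_t = σ_t Z_t`. -/
  eq_mul : ∀ t, ∀ᵐ ω ∂P, X t ω = σ t ω * Z t ω
  stationary : IsStationary P (fun t ω => (X t ω, σ t ω))

/-- The expectation of the extended-real-valued random variable `f` exists in `[-∞, ∞)` and is
strictly negative, that is, `E f⁺ < E f⁻` (the value `E f⁻ = ∞` is allowed, `E f⁺ = ∞` is not). -/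
def HasNegativeMean (P : Measure Ω) (f : Ω → EReal) : Prop :=
  ∫⁻ ω, (f ω).toENNReal ∂P < ∫⁻ ω, (-f ω).toENNReal ∂P

end Model

/-- The logarithm of a nonnegative real number, with `log 0 = -∞`. -/
noncomputable def extLog (x : ℝ) : EReal := ENNReal.log (ENNReal.ofReal x)

/-- `m = inf_{θ ∈ K} α / (1 - β)`. -/
noncomputable def lowerBound (K : Set Param) : ℝ := ⨅ θ : K, (θ : Param).α / (1 - (θ : Param).β)

/-- The Lipschitz-coefficient bound
`λ₀(θ) = max (β, 2⁻¹ exp (-m / 2) (γ x + δ |x|) - β)`, where `x` is the value of `X_0`. -/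
noncomputable def lipBound (K : Set Param) (x : ℝ) (θ : Param) : ℝ :=
  max θ.β (2⁻¹ * Real.exp (-lowerBound K / 2) * (θ.γ * x + θ.δ * |x|) - θ.β)

/-- The supremum norm `‖f‖_K = sup_{θ ∈ K} |f θ|` (for `f` bounded on the nonempty set `K`). -/
noncomputable def supNorm (K : Set Param) (f : Param → ℝ) : ℝ := ⨆ θ : K, |f θ|

/-- The volatility estimate `ĥ_t(θ)` computed from the data `x` and the initial value `ς² > 0`:
`ĥ_0 = ς²` and
`log ĥ_{t+1} = α + β log ĥ_t + (γ x_t + δ |x_t|) exp (-(log ĥ_t) / 2)`. -/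
noncomputable def hHat (s : ℝ) (x : ℤ → ℝ) (θ : Param) : ℕ → ℝ
  | 0 => s
  | t + 1 => Real.exp (θ.α + θ.β * Real.log (hHat s x θ t) +
      (θ.γ * x t + θ.δ * |x t|) * Real.exp (-Real.log (hHat s x θ t) / 2))

/-- The conditional Gaussian quasi-log-likelihood
`L̂_n(θ) = -½ ∑_{t=1}^n (x_t² / ĥ_t(θ) + log ĥ_t(θ))`. -/
noncomputable def logLik (s : ℝ) (x : ℤ → ℝ) (n : ℕ) (θ : Param) : ℝ :=
  -(1 / 2) * ∑ t ∈ Finset.Icc 1 n, ((x t) ^ 2 / hHat s x θ t + Real.log (hHat s x θ t))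

/-- `θ` is a quasi-maximum-likelihood estimate on `K` from the data `x` at sample size `n`. -/
def IsQMLE (s : ℝ) (x : ℤ → ℝ) (K : Set Param) (n : ℕ) (θ : Param) : Prop :=
  θ ∈ K ∧ IsMaxOn (logLik s x n) K θ

end EGARCH

/-!
Writing the data as a function of the i.i.d. innovations `z`, everything becomes a statement about
the ergodic shift on sequence space. Negativity of `E log ‖λ₀‖_K` makes the volatility recursion
contract uniformly in `θ ∈ K`, so the estimate `log ĥ_t(θ)` approaches, uniformly on `K`, the
stationary log-volatility `l_t(θ)` computed from the infinite past of the data, and `l_t(θ₀)` is the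
true log-volatility `log σ_t²`. Since `z_t` is independent of the past and has unit variance, the
stationary contrast `X_t² exp (-l_t(θ)) + l_t(θ)` has mean
`E (exp (log σ_t² - l_t(θ)) + l_t(θ)) ≥ E (1 + log σ_t²)`, with equality only if
`l_t(θ) = log σ_t²` almost surely; as the law of `Z_0` is not carried by two points, this forces
`θ = θ₀`. Following Wald, the contrast near a wrong parameter is bounded below by a bounded function
whose mean still exceeds `E (1 + log σ_t²)`, so the ergodic theorem and compactness exclude
maximizers far from `θ₀`. Only an upper ergodic bound for integrable functions is needed.
-/

namespace EGARCH

section Ergodic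

variable {S : Type*} {T : S → S} {f : S → ℝ}

/-- The maximum of the Birkhoff sums of `f` up to a given length, including the empty one. It is
defined by the recursion used in Garsia's proof of the maximal ergodic theorem. -/
def maxBirkhoff (T : S → S) (f : S → ℝ) : ℕ → S → ℝ
  | 0, _ => 0
  | n + 1, x => max 0 (f x + maxBirkhoff T f n (T x))

lemma maxBirkhoff_nonneg (n : ℕ) (x : S) : 0 ≤ maxBirkhoff T f n x := by
  cases n <;> simp [maxBirkhoff]

lemma add_maxBirkhoff_le (n : ℕ) (x : S) :
    f x + maxBirkhoff T f n (T x) ≤ maxBirkhoff T f (n + 1) x :=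
  le_max_right _ _

lemma monotone_maxBirkhoff (x : S) : Monotone fun n => maxBirkhoff T f n x := by
  refine monotone_nat_of_le_succ fun n => ?_
  induction n generalizing x with
  | zero => exact maxBirkhoff_nonneg 1 x
  | succ n ih => exact max_le_max le_rfl (add_le_add le_rfl (ih (T x)))

lemma birkhoffSum_le_maxBirkhoff (n : ℕ) (x : S) : birkhoffSum T f n x ≤ maxBirkhoff T f n x := by
  induction n generalizing x with
  | zero => simp [maxBirkhoff]
  | succ n ih =>
    rw [birkhoffSum_succ']
    exact (add_le_add le_rfl (ih (T x))).trans (add_maxBirkhoff_le n x)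

lemma maxBirkhoff_succ_sub (n : ℕ) (x : S) :
    maxBirkhoff T f (n + 1) x - maxBirkhoff T f n (T x) = max (-maxBirkhoff T f n (T x)) (f x) := by
  rw [maxBirkhoff, ← max_sub_sub_right, zero_sub, add_sub_cancel_right]

lemma bddAbove_maxBirkhoff_comp_iff (x : S) :
    BddAbove (Set.range fun n => maxBirkhoff T f n (T x)) ↔
      BddAbove (Set.range fun n => maxBirkhoff T f n x) := by
  simp only [bddAbove_def, Set.forall_mem_range]
  constructor
  · rintro ⟨b, hb⟩
    refine ⟨max 0 (f x + b), fun n => ?_⟩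
    cases n with
    | zero => exact le_max_left _ _
    | succ n => exact max_le_max le_rfl (add_le_add le_rfl (hb n))
  · rintro ⟨b, hb⟩
    exact ⟨b - f x, fun n => le_sub_iff_add_le'.mpr ((add_maxBirkhoff_le n x).trans (hb (n + 1)))⟩

variable [MeasurableSpace S] {μ : Measure S}

lemma measurable_maxBirkhoff (hT : Measurable T) (hf : Measurable f) (n : ℕ) :
    Measurable (maxBirkhoff T f n) := by
  induction n with
  | zero => exact measurable_const
  | succ n ih => exact measurable_const.max (hf.add (ih.comp hT))

lemma integrable_maxBirkhoff (hT : MeasurePreserving T μ μ) (hf : Integrable f μ) (n : ℕ) :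
    Integrable (maxBirkhoff T f n) μ := by
  induction n with
  | zero => exact integrable_zero S ℝ μ
  | succ n ih => exact (integrable_zero S ℝ μ).sup (hf.add (hT.integrable_comp_of_integrable ih))

lemma integral_max_neg_maxBirkhoff_nonneg (hT : MeasurePreserving T μ μ) (hf : Integrable f μ)
    (n : ℕ) : 0 ≤ ∫ x, max (-maxBirkhoff T f n (T x)) (f x) ∂μ := by
  have hint := integrable_maxBirkhoff hT hf
  have hintT : Integrable (fun x => maxBirkhoff T f n (T x)) μ :=
    hT.integrable_comp_of_integrable (hint n)
  have hcomp : ∫ x, maxBirkhoff T f n (T x) ∂μ = ∫ x, maxBirkhoff T f n x ∂μ := by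
    rw [← integral_map hT.aemeasurable (by simpa only [hT.map_eq] using (hint n).1), hT.map_eq]
  simp_rw [← maxBirkhoff_succ_sub]
  rw [integral_sub (hint (n + 1)) hintT, hcomp, sub_nonneg]
  exact integral_mono (hint n) (hint (n + 1)) fun x => monotone_maxBirkhoff x n.le_succ

lemma tendsto_integral_max_neg_maxBirkhoff (hT : MeasurePreserving T μ μ) (hf : Integrable f μ)
    (hunb : ∀ᵐ x ∂μ, ¬ BddAbove (Set.range fun n => maxBirkhoff T f n x)) :
    Tendsto (fun n => ∫ x, max (-maxBirkhoff T f n (T x)) (f x) ∂μ) atTop (𝓝 (∫ x, f x ∂μ)) := by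
  refine tendsto_integral_of_dominated_convergence (fun x => |f x|) (fun n => ?_) hf.abs
    (fun n => .of_forall fun x => ?_) ?_
  · exact ((hT.integrable_comp_of_integrable (integrable_maxBirkhoff hT hf n)).neg.sup hf).1
  · have h0 := maxBirkhoff_nonneg (T := T) (f := f) n (T x)
    exact abs_le.mpr ⟨(neg_abs_le _).trans (le_max_right _ _),
      max_le (by linarith [abs_nonneg (f x)]) (le_abs_self _)⟩
  · filter_upwards [hunb] with x hx
    have htop := tendsto_atTop_atTop_of_monotone' (monotone_maxBirkhoff (T x))
      (mt (bddAbove_maxBirkhoff_comp_iff x).mp hx)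
    refine tendsto_const_nhds.congr' ?_
    filter_upwards [htop.eventually_ge_atTop (-f x)] with n hn
    exact (max_eq_right (neg_le.mp hn)).symm

theorem ae_bddAbove_birkhoffSum (hT : Ergodic T μ) (hfm : Measurable f) (hf : Integrable f μ)
    (hneg : ∫ x, f x ∂μ < 0) :
    ∀ᵐ x ∂μ, BddAbove (Set.range fun n => birkhoffSum T f n x) := by
  have hA : MeasurableSet {x | BddAbove (Set.range fun n => maxBirkhoff T f n x)} :=
    measurableSet_bddAbove_range fun n => measurable_maxBirkhoff hT.measurable hfm n
  rcases hT.toPreErgodic.ae_mem_or_ae_notMem hA (Set.ext bddAbove_maxBirkhoff_comp_iff)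
    with hbdd | hunb
  · filter_upwards [hbdd] with x hx
    exact hx.range_mono _ fun n => birkhoffSum_le_maxBirkhoff n x
  · exact absurd (ge_of_tendsto' (tendsto_integral_max_neg_maxBirkhoff hT.toMeasurePreserving hf
      hunb) (integral_max_neg_maxBirkhoff_nonneg hT.toMeasurePreserving hf)) hneg.not_ge

theorem ae_eventually_birkhoffSum_le [IsProbabilityMeasure μ] (hT : Ergodic T μ)
    (hfm : Measurable f) (hf : Integrable f μ) {c : ℝ} (hc : ∫ x, f x ∂μ < c) :
    ∀ᵐ x ∂μ, ∀ᶠ n : ℕ in atTop, birkhoffSum T f n x ≤ c * n := by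
  obtain ⟨c', hc', hc'c⟩ := exists_between hc
  have hneg : ∫ x, (f x - c') ∂μ < 0 := by
    rw [integral_sub hf (integrable_const _)]
    simpa using hc'
  have htop : Tendsto (fun n : ℕ => (c - c') * (n : ℝ)) atTop atTop :=
    tendsto_natCast_atTop_atTop.const_mul_atTop (sub_pos.mpr hc'c)
  filter_upwards [ae_bddAbove_birkhoffSum hT (hfm.sub_const c') (hf.sub (integrable_const c'))
    hneg] with x ⟨b, hb⟩
  filter_upwards [htop.eventually_ge_atTop b] with n hn
  have hbn : birkhoffSum T (fun x => f x - c') n x ≤ b := hb ⟨n, rfl⟩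
  have hsum : birkhoffSum T (fun x => f x - c') n x = birkhoffSum T f n x - n * c' := by
    simp [birkhoffSum, Finset.sum_sub_distrib]
  linarith

end Ergodic

section ZeroOne

open scoped symmDiff

variable {S : Type*}

lemma inter_symmDiff_subset (A B C : Set S) : (B ∩ C) ∆ A ⊆ B ∆ A ∪ C ∆ A := by
  intro x
  simp only [Set.mem_symmDiff, Set.mem_inter_iff, Set.mem_union]
  tauto

variable [MeasurableSpace S] {μ : Measure S} [IsProbabilityMeasure μ]

lemma abs_measureReal_sub_sq_le {A B C : Set S} (hA : MeasurableSet A) (hB : MeasurableSet B)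
    (hC : MeasurableSet C) (hind : IndepSet B C μ) {ε : ℝ} (hBA : μ.real (B ∆ A) ≤ ε)
    (hCA : μ.real (C ∆ A) ≤ ε) : |μ.real A - μ.real A * μ.real A| ≤ 4 * ε := by
  have hmul : μ.real (B ∩ C) = μ.real B * μ.real C := by
    simp only [measureReal_def, hind.measure_inter_eq_mul, ENNReal.toReal_mul]
  have hdist {D : Set S} (hD : MeasurableSet D) :=
    abs_measureReal_sub_le_measureReal_symmDiff (μ := μ) hD.nullMeasurableSet hA.nullMeasurableSet
  have hinter : μ.real ((B ∩ C) ∆ A) ≤ 2 * ε :=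
    (measureReal_mono (inter_symmDiff_subset A B C)).trans
      ((measureReal_union_le _ _).trans (by linarith))
  have hprod : |μ.real B * μ.real C - μ.real A * μ.real A| ≤ 2 * ε := by
    have hBC : μ.real B * μ.real C - μ.real A * μ.real A =
        (μ.real B - μ.real A) * μ.real C + μ.real A * (μ.real C - μ.real A) := by ring
    rw [hBC]
    refine (abs_add_le _ _).trans ?_
    rw [abs_mul, abs_mul, abs_of_nonneg (measureReal_nonneg (μ := μ) (s := C)),
      abs_of_nonneg (measureReal_nonneg (μ := μ) (s := A))]
    have hCB := mul_le_of_le_one_right (abs_nonneg (μ.real B - μ.real A))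
      (measureReal_le_one (μ := μ) (s := C))
    have hAC := mul_le_of_le_one_left (abs_nonneg (μ.real C - μ.real A))
      (measureReal_le_one (μ := μ) (s := A))
    linarith [hdist hB, hdist hC]
  have hBCA := hdist (hB.inter hC)
  rw [hmul] at hBCA
  rw [abs_le] at *
  constructor <;> linarith

theorem measure_eq_zero_or_one_of_forall_indepSet_approx {A : Set S} (hA : MeasurableSet A)
    (happrox : ∀ ε > 0, ∃ B C, MeasurableSet B ∧ MeasurableSet C ∧ IndepSet B C μ ∧
      μ.real (B ∆ A) ≤ ε ∧ μ.real (C ∆ A) ≤ ε) : μ A = 0 ∨ μ A = 1 := by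
  have hsq : μ.real A = μ.real A * μ.real A := by
    refine eq_of_abs_sub_nonpos (le_of_forall_pos_le_add fun ε hε => ?_)
    obtain ⟨B, C, hB, hC, hind, hBA, hCA⟩ := happrox (ε / 4) (by positivity)
    linarith [abs_measureReal_sub_sq_le hA hB hC hind hBA hCA]
  refine measure_eq_zero_or_one_of_indepSet_self
    ((indepSet_iff_measure_inter_eq_mul hA hA μ).mpr ?_)
  rwa [Set.inter_self, ← ENNReal.toReal_eq_toReal_iff' (measure_ne_top _ _)
    (ENNReal.mul_ne_top (measure_ne_top _ _) (measure_ne_top _ _)), ENNReal.toReal_mul]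

end ZeroOne

section Shift

variable {E : Type*}

/-- The shift by `t` on two-sided sequences, `(z_k)_k ↦ (z_{k + t})_k`. -/
def seqShift (t : ℤ) (z : ℤ → E) : ℤ → E := fun k => z (k + t)

lemma seqShift_iterate (t : ℤ) (n : ℕ) : (seqShift t : (ℤ → E) → ℤ → E)^[n] = seqShift (n * t) := by
  induction n with
  | zero => funext z k; simp [seqShift]
  | succ n ih =>
    funext z k
    rw [Function.iterate_succ', Function.comp_apply, ih]
    simp only [seqShift, Nat.cast_succ]
    congr 1
    ring

lemma exists_disjoint_image_add_mul (I : Finset ℤ) {t : ℤ} (ht : t ≠ 0) :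
    ∃ n : ℕ, Disjoint I (I.image fun i => i + n * t) := by
  refine ⟨2 * I.sup Int.natAbs + 1, Finset.disjoint_left.mpr fun i hi hi' => ?_⟩
  obtain ⟨j, hj, hji⟩ := Finset.mem_image.mp hi'
  have hi_le := Finset.le_sup (f := Int.natAbs) hi
  have hj_le := Finset.le_sup (f := Int.natAbs) hj
  have hdist : (i - j).natAbs = (2 * I.sup Int.natAbs + 1) * t.natAbs := by
    rw [← hji, add_sub_cancel_left, Int.natAbs_mul, Int.natAbs_natCast]
  have hfar : 2 * I.sup Int.natAbs + 1 ≤ (i - j).natAbs :=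
    hdist ▸ Nat.le_mul_of_pos_right _ (Int.natAbs_pos.mpr ht)
  omega

variable [MeasurableSpace E]

lemma measurable_seqShift (t : ℤ) : Measurable (seqShift t : (ℤ → E) → ℤ → E) :=
  measurable_pi_lambda _ fun k => measurable_pi_apply (k + t)

/-- The law of a two-sided i.i.d. sequence with marginal `ν`. -/
noncomputable abbrev iidLaw (ν : Measure E) : Measure (ℤ → E) := Measure.infinitePi fun _ => ν

variable {ν : Measure E} [IsProbabilityMeasure ν]

lemma measurePreserving_seqShift (t : ℤ) : MeasurePreserving (seqShift t) (iidLaw ν) (iidLaw ν) :=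
  ⟨measurable_seqShift t, Measure.map_infinitePi_infinitePi_of_inj (P := fun _ : ℤ => ν)
    (add_left_injective t)⟩

lemma ae_forall_seqShift {p : (ℤ → E) → Prop} (h : ∀ᵐ z ∂(iidLaw ν), p z) :
    ∀ᵐ z ∂(iidLaw ν), ∀ t, p (seqShift t z) :=
  ae_all_iff.mpr fun t => (measurePreserving_seqShift t).quasiMeasurePreserving.ae h

lemma measurePreserving_eval_iidLaw (t : ℤ) :
    MeasurePreserving (fun z : ℤ → E => z t) (iidLaw ν) ν :=
  measurePreserving_eval_infinitePi (fun _ : ℤ => ν) t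

open scoped symmDiff

lemma indepSet_cylinder_preimage_seqShift {I : Finset ℤ} {B : Set (I → E)} (hB : MeasurableSet B)
    {t : ℤ} (ht : Disjoint I (I.image fun i => i + t)) :
    IndepSet (cylinder I B) (seqShift t ⁻¹' cylinder I B) (iidLaw ν) := by
  have hind := (iIndepFun_infinitePi (P := fun _ : ℤ => ν) (X := fun _ x => x)
    fun _ => measurable_id).indepFun_finset I (I.image fun i => i + t) ht measurable_pi_apply
  let unshift (y : (I.image fun i => i + t : Finset ℤ) → E) : I → E :=
    fun i => y ⟨i + t, Finset.mem_image_of_mem _ i.2⟩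
  have hunshift : Measurable unshift := measurable_pi_lambda _ fun i => measurable_pi_apply _
  have hcyl := hB.cylinder (α := fun _ => E) I
  refine (indepSet_iff_measure_inter_eq_mul hcyl (measurable_seqShift t hcyl) (iidLaw ν)).mpr ?_
  exact (hind.comp measurable_id hunshift).measure_inter_preimage_eq_mul B B hB hB

lemma exists_cylinder_measureReal_symmDiff_le {A : Set (ℤ → E)} (hA : MeasurableSet A) {ε : ℝ}
    (hε : 0 < ε) : ∃ (I : Finset ℤ) (B : Set (I → E)), MeasurableSet B ∧
      (iidLaw ν).real (cylinder I B ∆ A) ≤ ε := by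
  obtain ⟨B, hB, hBA⟩ := exists_measure_symmDiff_lt_of_generateFrom_isSetRing (μ := iidLaw ν)
    isSetRing_measurableCylinders
    ⟨{Set.univ}, Set.countable_singleton _, by
      simpa using univ_mem_measurableCylinders (fun _ : ℤ => E), by simp⟩
    generateFrom_measurableCylinders.symm hA (ENNReal.ofReal_pos.mpr hε)
  obtain ⟨I, B, hBm, rfl⟩ := (mem_measurableCylinders B).mp hB
  exact ⟨I, B, hBm, ENNReal.toReal_le_of_le_ofReal hε.le hBA.le⟩

theorem ergodic_seqShift {t : ℤ} (ht : t ≠ 0) : Ergodic (seqShift t) (iidLaw ν) := by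
  refine ⟨measurePreserving_seqShift t, ⟨fun A hA hinv => eventuallyConst_set'.mpr ?_⟩⟩
  suffices h01 : iidLaw ν A = 0 ∨ iidLaw ν A = 1 from
    h01.imp ae_eq_empty.mpr fun h1 => ae_eq_univ.mpr ((prob_compl_eq_zero_iff hA).mpr h1)
  refine measure_eq_zero_or_one_of_forall_indepSet_approx hA fun ε hε => ?_
  obtain ⟨I, B, hB, hBA⟩ := exists_cylinder_measureReal_symmDiff_le (ν := ν) hA hε
  obtain ⟨n, hn⟩ := exists_disjoint_image_add_mul I ht
  have hinv_n : seqShift (n * t) ⁻¹' A = A :=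
    seqShift_iterate (E := E) t n ▸ Function.IsFixedPt.preimage_iterate hinv n
  have hcyl := hB.cylinder (α := fun _ => E) I
  refine ⟨_, _, hcyl, measurable_seqShift _ hcyl, indepSet_cylinder_preimage_seqShift hB hn, hBA,
    ?_⟩
  rwa [← hinv_n, ← Set.preimage_symmDiff, measureReal_def,
    (measurePreserving_seqShift _).measure_preimage (hcyl.symmDiff hA).nullMeasurableSet]

end Shift

lemma le_prod_mul_of_succ_le {u c : ℕ → ℝ} (hc : ∀ n, 0 ≤ c n) (hu : ∀ n, u (n + 1) ≤ c n * u n)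
    (n : ℕ) : u n ≤ (∏ j ∈ Finset.range n, c j) * u 0 := by
  induction n with
  | zero => simp
  | succ n ih =>
    calc u (n + 1) ≤ c n * u n := hu n
      _ ≤ c n * ((∏ j ∈ Finset.range n, c j) * u 0) := mul_le_mul_of_nonneg_left ih (hc n)
      _ = (∏ j ∈ Finset.range (n + 1), c j) * u 0 := by rw [Finset.prod_range_succ]; ring

section Recursion

/-- The shock `γ x + δ |x|` in the recursion of the EGARCH model. -/
noncomputable def shock (θ : Param) (x : ℝ) : ℝ := θ.γ * x + θ.δ * |x|

/-- The fixed point `α / (1 - β)` of the recursion for the log-volatility without shocks. -/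
noncomputable def baseLevel (θ : Param) : ℝ := θ.α / (1 - θ.β)

/-- One step of the recursion for the log-volatility given the observation `x`. -/
noncomputable def logStep (x : ℝ) (θ : Param) (l : ℝ) : ℝ :=
  θ.α + θ.β * l + shock θ x * Real.exp (-l / 2)

/-- The random Lipschitz coefficient `‖λ₀‖_K` as a function of the observation. -/
noncomputable def lipSup (K : Set Param) (x : ℝ) : ℝ := supNorm K (lipBound K x)

@[fun_prop]
lemma measurable_shock (θ : Param) : Measurable (shock θ) := by
  unfold shock
  fun_prop

lemma continuous_logStep (x : ℝ) : Continuous fun p : Param × ℝ => logStep x p.1 p.2 := by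
  unfold logStep shock
  fun_prop

lemma continuous_lipBound (K : Set Param) : Continuous fun p : ℝ × Param => lipBound K p.1 p.2 := by
  unfold lipBound
  fun_prop

lemma continuousOn_baseLevel : ContinuousOn baseLevel paramSpace := by
  unfold baseLevel
  exact ContinuousOn.div (by fun_prop) (by fun_prop) fun θ hθ => (sub_pos.mpr hθ.2.1).ne'

lemma hasDerivAt_logStep (x : ℝ) (θ : Param) (l : ℝ) :
    HasDerivAt (logStep x θ) (θ.β - 2⁻¹ * (shock θ x * Real.exp (-l / 2))) l := by
  have hexp := ((hasDerivAt_id l).neg.div_const 2).exp.const_mul (shock θ x)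
  exact ((((hasDerivAt_id l).const_mul θ.β).const_add θ.α).add hexp).congr_deriv (by simp; ring)

lemma shock_mul {c : ℝ} (hc : 0 ≤ c) (θ : Param) (x : ℝ) : shock θ (c * x) = c * shock θ x := by
  rw [shock, shock, abs_mul, abs_of_nonneg hc]
  ring

section

variable {θ : Param} (hθ : θ ∈ paramSpace)

include hθ

lemma shock_nonneg (x : ℝ) : 0 ≤ shock θ x := by
  have hle : |θ.γ * x| ≤ θ.δ * |x| := by
    rw [abs_mul]
    exact mul_le_mul_of_nonneg_right hθ.2.2 (abs_nonneg x)
  rw [shock]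
  linarith [neg_abs_le (θ.γ * x)]

lemma α_add_β_mul_baseLevel : θ.α + θ.β * baseLevel θ = baseLevel θ := by
  have hb : baseLevel θ * (1 - θ.β) = θ.α := div_mul_cancel₀ _ (sub_pos.mpr hθ.2.1).ne'
  linarith

lemma logStep_baseLevel (x : ℝ) :
    logStep x θ (baseLevel θ) = baseLevel θ + shock θ x * Real.exp (-baseLevel θ / 2) := by
  rw [logStep, α_add_β_mul_baseLevel hθ]

lemma baseLevel_sub_logStep_le (x l : ℝ) :
    baseLevel θ - logStep x θ l ≤ θ.β * (baseLevel θ - l) := by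
  have hpos := mul_nonneg (shock_nonneg hθ x) (Real.exp_pos (-l / 2)).le
  rw [logStep]
  linarith [α_add_β_mul_baseLevel hθ]

end

variable {K : Set Param} (hK : IsCompact K)

lemma lipSup_nonneg (x : ℝ) : 0 ≤ lipSup K x := Real.iSup_nonneg fun _ => abs_nonneg _

include hK

lemma bddAbove_lipBound (x : ℝ) : BddAbove (Set.range fun θ : K => |lipBound K x θ|) := by
  have hcont : Continuous fun θ : Param => |lipBound K x θ| :=
    ((continuous_lipBound K).comp (Continuous.prodMk_right x)).abs
  simpa only [Set.image_eq_range] using hK.bddAbove_image hcont.continuousOn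

lemma lipBound_le_lipSup (x : ℝ) {θ : Param} (hθ : θ ∈ K) : lipBound K x θ ≤ lipSup K x :=
  (le_abs_self _).trans (le_ciSup (bddAbove_lipBound hK x) (⟨θ, hθ⟩ : K))

lemma β_le_lipSup (x : ℝ) {θ : Param} (hθ : θ ∈ K) : θ.β ≤ lipSup K x :=
  (le_max_left _ _).trans (lipBound_le_lipSup hK x hθ)

lemma shock_mul_exp_le_lipSup_add_β (x : ℝ) {θ : Param} (hθ : θ ∈ K) :
    2⁻¹ * (shock θ x * Real.exp (-lowerBound K / 2)) ≤ lipSup K x + θ.β := by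
  have hle := (le_max_right _ _).trans (lipBound_le_lipSup hK x hθ)
  rw [shock]
  linarith

lemma measurable_lipSup (hne : K.Nonempty) : Measurable (lipSup K) := by
  have : Nonempty K := hne.to_subtype
  have hlsc : LowerSemicontinuous fun x => ⨆ θ : K, |lipBound K x θ| :=
    lowerSemicontinuous_ciSup (bddAbove_lipBound hK) fun θ =>
      ((continuous_lipBound K).comp (Continuous.prodMk_left (θ : Param))).abs.lowerSemicontinuous
  exact hlsc.measurable

variable (hKΘ : K ⊆ paramSpace)

include hKΘ

lemma lowerBound_le_baseLevel {θ : Param} (hθ : θ ∈ K) : lowerBound K ≤ baseLevel θ := by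
  have hbdd := hK.bddBelow_image (continuousOn_baseLevel.mono hKΘ)
  rw [Set.image_eq_range] at hbdd
  exact ciInf_le hbdd (⟨θ, hθ⟩ : K)

lemma exists_forall_β_le : ∃ B, 0 ≤ B ∧ B < 1 ∧ ∀ θ ∈ K, θ.β ≤ B := by
  rcases K.eq_empty_or_nonempty with rfl | hne
  · exact ⟨0, le_rfl, one_pos, by simp⟩
  · obtain ⟨θ, hθ, hmax⟩ := hK.exists_isMaxOn (f := Param.β) hne (by fun_prop)
    exact ⟨θ.β, (hKΘ hθ).1, (hKΘ hθ).2.1, hmax⟩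

lemma abs_deriv_logStep_le (x : ℝ) {θ : Param} (hθ : θ ∈ K) {ε l : ℝ} (hε : 0 ≤ ε)
    (hl : lowerBound K - ε ≤ l) :
    |θ.β - 2⁻¹ * (shock θ x * Real.exp (-l / 2))| ≤ Real.exp ε * lipSup K x := by
  have hβ0 := (hKΘ hθ).1
  have hβ := β_le_lipSup hK x hθ
  have hshock := shock_mul_exp_le_lipSup_add_β hK x hθ
  have hs := shock_nonneg (hKΘ hθ) x
  set q := Real.exp (ε / 2)
  have hq : 1 ≤ q := Real.one_le_exp (by linarith)
  have hqq : Real.exp ε = q * q := by rw [← Real.exp_add, add_halves]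
  have hexp : Real.exp (-l / 2) ≤ Real.exp (-lowerBound K / 2) * q := by
    rw [← Real.exp_add]
    exact Real.exp_le_exp.mpr (by linarith)
  have hupper : 2⁻¹ * (shock θ x * Real.exp (-l / 2)) ≤ (lipSup K x + θ.β) * q :=
    calc 2⁻¹ * (shock θ x * Real.exp (-l / 2))
        ≤ 2⁻¹ * (shock θ x * (Real.exp (-lowerBound K / 2) * q)) := by gcongr
      _ = 2⁻¹ * (shock θ x * Real.exp (-lowerBound K / 2)) * q := by ring
      _ ≤ (lipSup K x + θ.β) * q := by gcongr
  have hlower : 0 ≤ 2⁻¹ * (shock θ x * Real.exp (-l / 2)) := by positivity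
  have hβq : (q - 1) * θ.β ≤ (q - 1) * lipSup K x := by gcongr
  rw [hqq, abs_le]
  constructor <;> nlinarith [mul_nonneg (sq_nonneg (q - 1)) (hβ0.trans hβ)]

lemma abs_logStep_sub_le (x : ℝ) {θ : Param} (hθ : θ ∈ K) {ε u v : ℝ} (hε : 0 ≤ ε)
    (hu : lowerBound K - ε ≤ u) (hv : lowerBound K - ε ≤ v) :
    |logStep x θ u - logStep x θ v| ≤ Real.exp ε * lipSup K x * |u - v| :=
  (convex_Ici (lowerBound K - ε)).norm_image_sub_le_of_norm_hasDerivWithin_le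
    (fun l _ => (hasDerivAt_logStep x θ l).hasDerivWithinAt)
    (fun _ hl => abs_deriv_logStep_le hK hKΘ x hθ hε hl) hv hu

lemma abs_sub_le_prod_mul_of_logStep {x u v ε : ℕ → ℝ} {θ : Param} (hθ : θ ∈ K)
    (hε : ∀ n, 0 ≤ ε n) (hu : ∀ n, u (n + 1) = logStep (x n) θ (u n))
    (hv : ∀ n, v (n + 1) = logStep (x n) θ (v n)) (hu_ge : ∀ n, lowerBound K - ε n ≤ u n)
    (hv_ge : ∀ n, lowerBound K - ε n ≤ v n) (n : ℕ) :
    |u n - v n| ≤ (∏ j ∈ Finset.range n, Real.exp (ε j) * lipSup K (x j)) * |u 0 - v 0| := by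
  refine le_prod_mul_of_succ_le (u := fun n => |u n - v n|)
    (fun n => mul_nonneg (Real.exp_pos _).le (lipSup_nonneg _)) (fun n => ?_) n
  rw [hu, hv]
  exact abs_logStep_sub_le hK hKΘ (x n) hθ (hε n) (hu_ge n) (hv_ge n)

end Recursion

section Stationary

/-- The log-volatility at time `t` computed from the data `x` by running the recursion for `n`
steps from the level `α / (1 - β)`. -/
noncomputable def backIter (x : ℤ → ℝ) (θ : Param) : ℕ → ℤ → ℝ
  | 0, _ => baseLevel θ
  | n + 1, t => logStep (x (t - 1)) θ (backIter x θ n (t - 1))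

/-- The log-volatility at time `t` computed from the infinite past of `x`. It is a limit along
contractive data; `limsup` makes it measurable in `x` everywhere. -/
noncomputable def statLog (x : ℤ → ℝ) (θ : Param) (t : ℤ) : ℝ :=
  limsup (fun n => backIter x θ n t) atTop

/-- The product of the Lipschitz coefficients over the `n` observations preceding `t`. -/
noncomputable def backProd (K : Set Param) (x : ℤ → ℝ) (t : ℤ) (n : ℕ) : ℝ :=
  ∏ j ∈ Finset.range n, lipSup K (x (t - 1 - j))

/-- The product of the Lipschitz coefficients of the first `n` observations. -/
noncomputable def forwProd (K : Set Param) (x : ℤ → ℝ) (n : ℕ) : ℝ :=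
  ∏ j ∈ Finset.range n, lipSup K (x j)

/-- Contractivity on average of the recursion along the data `x`: the initial value is forgotten
when time runs forward, and the recursion started in the remote past converges. -/
structure IsContractive (K : Set Param) (x : ℤ → ℝ) : Prop where
  summable_backProd : ∀ t, Summable fun n => backProd K x t n
  tendsto_forwProd : Tendsto (forwProd K x) atTop (𝓝 0)

lemma backProd_succ (K : Set Param) (x : ℤ → ℝ) (t : ℤ) (n : ℕ) :
    backProd K x t (n + 1) = lipSup K (x (t - 1)) * backProd K x (t - 1) n := by
  rw [backProd, Finset.prod_range_succ', mul_comm, backProd, Nat.cast_zero, sub_zero]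
  refine congrArg _ (Finset.prod_congr rfl fun j _ => ?_)
  rw [Nat.cast_succ, sub_sub (t - 1), add_comm]

variable {K : Set Param} (hK : IsCompact K) (hKΘ : K ⊆ paramSpace) {θ : Param}

lemma baseLevel_le_backIter (hθ : θ ∈ paramSpace) (x : ℤ → ℝ) (n : ℕ) (t : ℤ) :
    baseLevel θ ≤ backIter x θ n t := by
  induction n generalizing t with
  | zero => exact le_rfl
  | succ n ih =>
    have hstep := baseLevel_sub_logStep_le hθ (x (t - 1)) (backIter x θ n (t - 1))
    have hβ := mul_nonpos_of_nonneg_of_nonpos hθ.1 (sub_nonpos.mpr (ih (t - 1)))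
    exact sub_nonpos.mp (hstep.trans hβ)

include hKΘ in
lemma continuousOn_backIter (x : ℤ → ℝ) (n : ℕ) (t : ℤ) :
    ContinuousOn (fun θ => backIter x θ n t) K := by
  induction n generalizing t with
  | zero => exact continuousOn_baseLevel.mono hKΘ
  | succ n ih =>
    exact (continuous_logStep (x (t - 1))).comp_continuousOn (continuousOn_id.prodMk (ih (t - 1)))

include hK hKΘ

lemma lowerBound_le_backIter (x : ℤ → ℝ) (hθ : θ ∈ K) (n : ℕ) (t : ℤ) :
    lowerBound K ≤ backIter x θ n t :=
  (lowerBound_le_baseLevel hK hKΘ hθ).trans (baseLevel_le_backIter (hKΘ hθ) x n t)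

lemma abs_backIter_one_sub_le (x : ℤ → ℝ) (hθ : θ ∈ K) (t : ℤ) :
    |backIter x θ 1 t - backIter x θ 0 t| ≤ 4 * backProd K x t 1 := by
  have hs := shock_nonneg (hKΘ hθ) (x (t - 1))
  have hdiff : backIter x θ 1 t - backIter x θ 0 t =
      shock θ (x (t - 1)) * Real.exp (-baseLevel θ / 2) := by
    simp only [backIter, logStep_baseLevel (hKΘ hθ), add_sub_cancel_left]
  have hexp : Real.exp (-baseLevel θ / 2) ≤ Real.exp (-lowerBound K / 2) :=
    Real.exp_le_exp.mpr (by linarith [lowerBound_le_baseLevel hK hKΘ hθ])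
  have hprod : backProd K x t 1 = lipSup K (x (t - 1)) := by simp [backProd]
  rw [hdiff, abs_of_nonneg (mul_nonneg hs (Real.exp_pos _).le), hprod]
  linarith [mul_le_mul_of_nonneg_left hexp hs, β_le_lipSup hK (x (t - 1)) hθ,
    shock_mul_exp_le_lipSup_add_β hK (x (t - 1)) hθ]

lemma abs_backIter_succ_sub_le (x : ℤ → ℝ) (hθ : θ ∈ K) (n : ℕ) (t : ℤ) :
    |backIter x θ (n + 1) t - backIter x θ n t| ≤ 4 * backProd K x t (n + 1) := by
  induction n generalizing t with
  | zero => exact abs_backIter_one_sub_le hK hKΘ x hθ t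
  | succ n ih =>
    have hlip := abs_logStep_sub_le hK hKΘ (x (t - 1)) hθ le_rfl
      (by simpa using lowerBound_le_backIter hK hKΘ x hθ (n + 1) (t - 1))
      (by simpa using lowerBound_le_backIter hK hKΘ x hθ n (t - 1))
    rw [Real.exp_zero, one_mul] at hlip
    calc |backIter x θ (n + 1 + 1) t - backIter x θ (n + 1) t|
        ≤ lipSup K (x (t - 1)) * |backIter x θ (n + 1) (t - 1) - backIter x θ n (t - 1)| := hlip
      _ ≤ lipSup K (x (t - 1)) * (4 * backProd K x (t - 1) (n + 1)) :=
          mul_le_mul_of_nonneg_left (ih (t - 1)) (lipSup_nonneg _)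
      _ = 4 * backProd K x t (n + 1 + 1) := by rw [backProd_succ K x t]; ring

variable {x : ℤ → ℝ} (hx : IsContractive K x)

include hx

omit hK hKΘ in
lemma summable_four_mul_backProd_succ (t : ℤ) : Summable fun n => 4 * backProd K x t (n + 1) :=
  ((summable_nat_add_iff 1).mpr (hx.summable_backProd t)).mul_left 4

lemma tendsto_backIter (hθ : θ ∈ K) (t : ℤ) :
    Tendsto (fun n => backIter x θ n t) atTop (𝓝 (statLog x θ t)) := by
  have hcauchy : CauchySeq fun n => backIter x θ n t := by
    refine cauchySeq_of_dist_le_of_summable _ (fun n => ?_) (summable_four_mul_backProd_succ hx t)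
    rw [dist_comm, Real.dist_eq]
    exact abs_backIter_succ_sub_le hK hKΘ x hθ n t
  obtain ⟨l, hl⟩ := cauchySeq_tendsto_of_complete hcauchy
  rwa [statLog, hl.limsup_eq]

lemma lowerBound_le_statLog (hθ : θ ∈ K) (t : ℤ) : lowerBound K ≤ statLog x θ t :=
  ge_of_tendsto' (tendsto_backIter hK hKΘ hx hθ t) fun n => lowerBound_le_backIter hK hKΘ x hθ n t

lemma statLog_succ (hθ : θ ∈ K) (t : ℤ) :
    statLog x θ (t + 1) = logStep (x t) θ (statLog x θ t) := by
  have hcont : Continuous (logStep (x t) θ) :=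
    (continuous_logStep (x t)).comp (Continuous.prodMk_right θ)
  have hsucc := (tendsto_backIter hK hKΘ hx hθ (t + 1)).comp (tendsto_add_atTop_nat 1)
  refine tendsto_nhds_unique hsucc
    (((hcont.tendsto _).comp (tendsto_backIter hK hKΘ hx hθ t)).congr fun n => ?_)
  simp only [Function.comp_apply, backIter, add_sub_cancel_right]

lemma tendstoUniformlyOn_backIter (t : ℤ) :
    TendstoUniformlyOn (fun n θ => backIter x θ n t) (fun θ => statLog x θ t) atTop K := by
  have hsum := summable_four_mul_backProd_succ hx t
  rw [Metric.tendstoUniformlyOn_iff]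
  intro ε hε
  filter_upwards [(tendsto_sum_nat_add fun n => 4 * backProd K x t (n + 1)).eventually_lt_const hε]
    with n hn θ hθ
  rw [dist_comm]
  refine (dist_le_tsum_of_dist_le_of_tendsto _ (fun n => ?_) hsum
    (tendsto_backIter hK hKΘ hx hθ t) n).trans_lt (by simpa only [add_comm n] using hn)
  rw [dist_comm, Real.dist_eq]
  exact abs_backIter_succ_sub_le hK hKΘ x hθ n t

lemma continuousOn_statLog (t : ℤ) : ContinuousOn (fun θ => statLog x θ t) K :=
  (tendstoUniformlyOn_backIter hK hKΘ hx t).continuousOn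
    (Frequently.of_forall fun n => continuousOn_backIter hKΘ x n t)

end Stationary

section Estimate

/-- The summand `x² / h + log h` of minus twice the quasi-log-likelihood, as a function of the
observation `x` and of `l = log h`. -/
noncomputable def contrast (x l : ℝ) : ℝ := x ^ 2 * Real.exp (-l) + l

lemma log_hHat_succ (s : ℝ) (x : ℤ → ℝ) (θ : Param) (t : ℕ) :
    Real.log (hHat s x θ (t + 1)) = logStep (x t) θ (Real.log (hHat s x θ t)) := by
  rw [hHat, Real.log_exp, logStep, shock, neg_div]

lemma hHat_pos {s : ℝ} (hs : 0 < s) (x : ℤ → ℝ) (θ : Param) (t : ℕ) : 0 < hHat s x θ t := by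
  cases t with
  | zero => exact hs
  | succ t => exact Real.exp_pos _

lemma continuous_log_hHat (s : ℝ) (x : ℤ → ℝ) (t : ℕ) :
    Continuous fun θ => Real.log (hHat s x θ t) := by
  induction t with
  | zero => simpa only [hHat] using continuous_const
  | succ t ih =>
    simp_rw [log_hHat_succ]
    exact (continuous_logStep (x t)).comp (continuous_id'.prodMk ih)

lemma logLik_eq_sum_contrast {s : ℝ} (hs : 0 < s) (x : ℤ → ℝ) (n : ℕ) (θ : Param) :
    logLik s x n θ =
      -(1 / 2) * ∑ t ∈ Finset.Icc 1 n, contrast (x t) (Real.log (hHat s x θ t)) := by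
  refine congrArg _ (Finset.sum_congr rfl fun t _ => ?_)
  rw [contrast, Real.exp_neg, Real.exp_log (hHat_pos hs x θ t), div_eq_mul_inv]

theorem exists_isQMLE {K : Set Param} (hK : IsCompact K) (hne : K.Nonempty) {s : ℝ} (hs : 0 < s)
    (x : ℤ → ℝ) (n : ℕ) : ∃ θ, IsQMLE s x K n θ := by
  have hcont : Continuous (logLik s x n) := by
    simp_rw [funext (logLik_eq_sum_contrast hs x n), contrast]
    refine continuous_const.mul (continuous_finsetSum _ fun t _ => ?_)
    have := continuous_log_hHat s x t
    fun_prop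
  exact hK.exists_isMaxOn hne hcont.continuousOn

lemma baseLevel_sub_log_hHat_le {θ : Param} (hθ : θ ∈ paramSpace) (s : ℝ) (x : ℤ → ℝ) (t : ℕ) :
    baseLevel θ - Real.log (hHat s x θ t) ≤ θ.β ^ t * (baseLevel θ - Real.log s) := by
  have hrec := le_prod_mul_of_succ_le (u := fun t => baseLevel θ - Real.log (hHat s x θ t))
    (c := fun _ => θ.β) (fun _ => hθ.1) (fun t => by
      rw [log_hHat_succ]
      exact baseLevel_sub_logStep_le hθ _ _) t
  simpa only [Finset.prod_const, Finset.card_range, hHat] using hrec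

lemma exists_lowerBound_sub_le_log_hHat {K : Set Param} (hK : IsCompact K) (hKΘ : K ⊆ paramSpace)
    (s : ℝ) : ∃ ε : ℕ → ℝ, (∀ t, 0 ≤ ε t) ∧ Summable ε ∧
      ∀ (x : ℤ → ℝ) (t : ℕ), ∀ θ ∈ K, lowerBound K - ε t ≤ Real.log (hHat s x θ t) := by
  obtain ⟨B, hB0, hB1, hB⟩ := exists_forall_β_le hK hKΘ
  obtain ⟨C, hC⟩ := hK.exists_bound_of_continuousOn
    ((continuousOn_baseLevel.mono hKΘ).sub (continuousOn_const (c := Real.log s)))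
  refine ⟨fun t => B ^ t * |C|, fun t => by positivity,
    (summable_geometric_of_lt_one hB0 hB1).mul_right _, fun x t θ hθ => ?_⟩
  have hpow : θ.β ^ t * (baseLevel θ - Real.log s) ≤ B ^ t * |C| := by
    have hle := (le_abs_self _).trans ((hC θ hθ).trans (le_abs_self C))
    have hβ0 := (hKΘ hθ).1
    exact (mul_le_mul_of_nonneg_left hle (pow_nonneg hβ0 t)).trans
      (mul_le_mul_of_nonneg_right (pow_le_pow_left₀ hβ0 (hB θ hθ) t) (abs_nonneg C))
  linarith [baseLevel_sub_log_hHat_le (hKΘ hθ) s x t, lowerBound_le_baseLevel hK hKΘ hθ]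

lemma prod_exp_mul_lipSup_le {ε : ℕ → ℝ} (hε : ∀ n, 0 ≤ ε n) (hsum : Summable ε) (K : Set Param)
    (x : ℤ → ℝ) (n : ℕ) : ∏ j ∈ Finset.range n, Real.exp (ε j) * lipSup K (x j) ≤
      Real.exp (∑' j, ε j) * forwProd K x n := by
  rw [Finset.prod_mul_distrib, ← Real.exp_sum, forwProd]
  exact mul_le_mul_of_nonneg_right (Real.exp_le_exp.mpr (hsum.sum_le_tsum _ fun j _ => hε j))
    (Finset.prod_nonneg fun _ _ => lipSup_nonneg _)

theorem exists_abs_log_hHat_sub_statLog_le {K : Set Param} (hK : IsCompact K)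
    (hKΘ : K ⊆ paramSpace) {x : ℤ → ℝ} (hx : IsContractive K x) (s : ℝ) :
    ∃ E : ℕ → ℝ, Tendsto E atTop (𝓝 0) ∧
      ∀ t : ℕ, ∀ θ ∈ K, |Real.log (hHat s x θ t) - statLog x θ t| ≤ E t := by
  obtain ⟨ε, hε, hsum, hlow⟩ := exists_lowerBound_sub_le_log_hHat hK hKΘ s
  obtain ⟨D, hD⟩ := hK.exists_bound_of_continuousOn
    ((continuousOn_statLog hK hKΘ hx 0).sub (continuousOn_const (c := Real.log s)))
  refine ⟨fun t => Real.exp (∑' j, ε j) * forwProd K x t * D, ?_, fun t θ hθ => ?_⟩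
  · simpa using (hx.tendsto_forwProd.const_mul (Real.exp (∑' j, ε j))).mul_const D
  have hstat (n : ℕ) : lowerBound K - ε n ≤ statLog x θ n :=
    (sub_le_self _ (hε n)).trans (lowerBound_le_statLog hK hKΘ hx hθ n)
  have hprod := abs_sub_le_prod_mul_of_logStep hK hKΘ (x := fun n => x n) hθ hε
    (log_hHat_succ s x θ) (fun n => by exact_mod_cast statLog_succ hK hKΘ hx hθ n)
    (fun n => hlow x n θ hθ) hstat t
  have hinit : |Real.log (hHat s x θ 0) - statLog x θ (0 : ℕ)| ≤ D := by
    rw [abs_sub_comm]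
    exact hD θ hθ
  exact hprod.trans (mul_le_mul (prod_exp_mul_lipSup_le hε hsum K x t) hinit (abs_nonneg _)
    (mul_nonneg (Real.exp_pos _).le (Finset.prod_nonneg fun _ _ => lipSup_nonneg _)))

end Estimate

section ConvergenceInMeasure

variable {Ω Ω' F : Type*} [MeasurableSpace Ω] [MeasurableSpace Ω'] {P : Measure Ω} {Q : Measure Ω'}

lemma tendstoInMeasure_zero_iff_of_identDistrib [NormedAddCommGroup F] [MeasurableSpace F]
    [OpensMeasurableSpace F] {ι : Type*} {l : Filter ι} {f : ι → Ω → F} {g : ι → Ω' → F}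
    (hfg : ∀ i, IdentDistrib (f i) (g i) P Q) :
    TendstoInMeasure P f l 0 ↔ TendstoInMeasure Q g l 0 := by
  simp only [tendstoInMeasure_iff_norm, Pi.zero_apply, sub_zero]
  refine forall₂_congr fun ε _ => tendsto_congr fun i => ?_
  exact (hfg i).measure_mem_eq (measurableSet_le measurable_const measurable_norm)

lemma tendstoInMeasure_mul_zero_of_identDistrib [IsFiniteMeasure Q] {Y : ℕ → Ω → ℝ} {Y' : Ω' → ℝ}
    (hY : ∀ n, IdentDistrib (Y n) Y' P Q) {b : ℕ → ℝ} (hb : Tendsto b atTop (𝓝 0)) :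
    TendstoInMeasure P (fun n ω => b n * Y n ω) atTop 0 := by
  rw [tendstoInMeasure_zero_iff_of_identDistrib fun n => (hY n).const_mul (b n)]
  refine tendstoInMeasure_of_tendsto_ae (fun n => ?_) (ae_of_all _ fun ω => ?_)
  · exact ((hY 0).aemeasurable_snd.const_mul (b n)).aestronglyMeasurable
  · simpa only [zero_mul, Pi.zero_apply] using hb.mul_const (Y' ω)

lemma ae_eq_zero_of_ae_tendsto_comp [IsFiniteMeasure Q] {T : ℕ → Ω' → Ω'} {d : Ω' → ℝ}
    (hd : Measurable d) (hT : ∀ n, MeasurePreserving (T n) Q Q)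
    (hlim : ∀ᵐ ω ∂Q, Tendsto (fun n => d (T n ω)) atTop (𝓝 0)) : d =ᵐ[Q] 0 := by
  have hident (n : ℕ) : IdentDistrib (fun ω => d (T n ω)) d Q Q :=
    IdentDistrib.comp ⟨(hT n).aemeasurable, aemeasurable_id,
      (hT n).map_eq.trans Measure.map_id.symm⟩ hd
  have hcomp : TendstoInMeasure Q (fun n ω => d (T n ω)) atTop 0 :=
    tendstoInMeasure_of_tendsto_ae
      (fun n => (hd.comp (hT n).measurable).aestronglyMeasurable) hlim
  have hconst : TendstoInMeasure Q (fun _ : ℕ => d) atTop d :=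
    tendstoInMeasure_of_tendsto_ae (fun _ => hd.aestronglyMeasurable)
      (ae_of_all _ fun _ => tendsto_const_nhds)
  exact tendstoInMeasure_ae_unique hconst
    ((tendstoInMeasure_zero_iff_of_identDistrib hident).mp hcomp)

lemma ae_eq_zero_of_eq_sub_of_tendstoInMeasure {D : Ω → ℝ} {U V : ℕ → Ω → ℝ}
    (hD : ∀ᵐ ω ∂P, ∀ n, D ω = U n ω - V n ω) (hU : TendstoInMeasure P U atTop 0)
    (hV : TendstoInMeasure P V atTop 0) : D =ᵐ[P] 0 := by
  obtain ⟨n, hn, hUn⟩ := hU.exists_seq_tendsto_ae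
  obtain ⟨m, hm, hVm⟩ := (hV.comp hn.tendsto_atTop).exists_seq_tendsto_ae
  filter_upwards [hD, hUn, hVm] with ω hDω hUω hVω
  have hlim := (hUω.comp hm.tendsto_atTop).sub hVω
  simp only [Function.comp_def, ← hDω, Pi.zero_apply, sub_zero] at hlim
  exact tendsto_nhds_unique tendsto_const_nhds hlim

end ConvergenceInMeasure

section Canonical

/-- The discounted sum of the past shocks `∑ βᵏ (γ z_{t-1-k} + δ |z_{t-1-k}|)`. -/
noncomputable def shockSum (θ : Param) (z : ℤ → ℝ) (t : ℤ) : ℝ≥0∞ :=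
  ∑' k : ℕ, ENNReal.ofReal (θ.β ^ k * shock θ (z (t - 1 - k)))

/-- The stationary log-volatility `log σ_t²` as a function of the innovations. -/
noncomputable def logVol (θ : Param) (z : ℤ → ℝ) (t : ℤ) : ℝ :=
  baseLevel θ + (shockSum θ z t).toReal

/-- The stationary EGARCH process as a function of the innovations. -/
noncomputable def egarch (θ : Param) (z : ℤ → ℝ) (t : ℤ) : ℝ :=
  Real.exp (logVol θ z t / 2) * z t

lemma shockSum_seqShift (θ : Param) (z : ℤ → ℝ) (s t : ℤ) :
    shockSum θ (seqShift s z) t = shockSum θ z (t + s) := by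
  have hidx (k : ℕ) : t - 1 - k + s = t + s - 1 - k := by ring
  simp only [shockSum, seqShift, hidx]

lemma logVol_seqShift (θ : Param) (z : ℤ → ℝ) (s t : ℤ) :
    logVol θ (seqShift s z) t = logVol θ z (t + s) := by
  rw [logVol, logVol, shockSum_seqShift]

lemma egarch_seqShift (θ : Param) (z : ℤ → ℝ) (s t : ℤ) :
    egarch θ (seqShift s z) t = egarch θ z (t + s) := by
  rw [egarch, egarch, logVol_seqShift, seqShift]

lemma measurable_shockSum (θ : Param) (t : ℤ) : Measurable fun z => shockSum θ z t := by
  unfold shockSum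
  fun_prop

lemma measurable_logVol (θ : Param) (t : ℤ) : Measurable fun z => logVol θ z t :=
  (measurable_shockSum θ t).ennreal_toReal.const_add _

lemma measurable_egarch (θ : Param) (t : ℤ) : Measurable fun z => egarch θ z t :=
  ((measurable_logVol θ t).div_const 2).exp.mul (measurable_pi_apply t)

lemma shock_egarch_mul_exp (θ₀ θ : Param) (z : ℤ → ℝ) (t : ℤ) :
    shock θ (egarch θ₀ z t) * Real.exp (-logVol θ₀ z t / 2) = shock θ (z t) := by
  rw [egarch, shock_mul (Real.exp_pos _).le, mul_right_comm, ← Real.exp_add, neg_div,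
    add_neg_cancel, Real.exp_zero, one_mul]

lemma dependsOn_logVol (θ : Param) (t : ℤ) : DependsOn (fun z => logVol θ z t) (Set.Iio t) := by
  intro z w hzw
  have hpast (k : ℕ) : z (t - 1 - k) = w (t - 1 - k) := hzw _ (Set.mem_Iio.mpr (by lia))
  simp only [logVol, shockSum, hpast]

lemma dependsOn_egarch (θ : Param) (t : ℤ) : DependsOn (fun z => egarch θ z t) (Set.Iic t) := by
  intro z w hzw
  have hlogVol : logVol θ z t = logVol θ w t :=
    dependsOn_logVol θ t fun k hk => hzw k (Set.Iio_subset_Iic_self hk)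
  simp only [egarch, hlogVol, hzw t Set.self_mem_Iic]

lemma baseLevel_le_logVol (θ : Param) (z : ℤ → ℝ) (t : ℤ) : baseLevel θ ≤ logVol θ z t :=
  le_add_of_nonneg_right ENNReal.toReal_nonneg

variable {θ : Param} (hθ : θ ∈ paramSpace)

include hθ

lemma shockSum_succ (z : ℤ → ℝ) (t : ℤ) :
    shockSum θ z (t + 1) =
      ENNReal.ofReal (shock θ (z t)) + ENNReal.ofReal θ.β * shockSum θ z t := by
  have hidx (k : ℕ) : t + 1 - 1 - ((k + 1 : ℕ) : ℤ) = t - 1 - k := by push_cast; ring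
  rw [shockSum, tsum_eq_zero_add' ENNReal.summable, shockSum, ← ENNReal.tsum_mul_left]
  congr 1
  · simp
  · exact tsum_congr fun k => by rw [hidx, ← ENNReal.ofReal_mul hθ.1, pow_succ', mul_assoc]

lemma logVol_succ {z : ℤ → ℝ} {t : ℤ} (hfin : shockSum θ z t ≠ ∞) :
    logVol θ z (t + 1) = θ.α + θ.β * logVol θ z t + shock θ (z t) := by
  rw [logVol, shockSum_succ hθ, ENNReal.toReal_add ENNReal.ofReal_ne_top
    (ENNReal.mul_ne_top ENNReal.ofReal_ne_top hfin), ENNReal.toReal_mul,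
    ENNReal.toReal_ofReal hθ.1, ENNReal.toReal_ofReal (shock_nonneg hθ _), logVol]
  linarith [α_add_β_mul_baseLevel hθ]

lemma logVol_succ_eq_logStep {z : ℤ → ℝ} {t : ℤ} (hfin : shockSum θ z t ≠ ∞) :
    logVol θ z (t + 1) = logStep (egarch θ z t) θ (logVol θ z t) := by
  rw [logVol_succ hθ hfin, logStep, shock_egarch_mul_exp]

variable {ν : Measure ℝ} [IsProbabilityMeasure ν] (hν : Integrable id ν)

include hν

lemma lintegral_shockSum_ne_top (t : ℤ) : ∫⁻ z, shockSum θ z t ∂(iidLaw ν) ≠ ∞ := by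
  have hshock : ∫⁻ y, ENNReal.ofReal (shock θ y) ∂ν ≠ ∞ :=
    ((hν.const_mul θ.γ).add (hν.abs.const_mul θ.δ)).lintegral_lt_top.ne
  have hmeas (k : ℕ) :
      AEMeasurable (fun z => ENNReal.ofReal (θ.β ^ k * shock θ (z (t - 1 - k)))) (iidLaw ν) :=
    (((measurable_shock θ).comp (measurable_pi_apply _)).const_mul _).ennreal_ofReal.aemeasurable
  have hterm (k : ℕ) : ∫⁻ z, ENNReal.ofReal (θ.β ^ k * shock θ (z (t - 1 - k))) ∂(iidLaw ν) =
      ENNReal.ofReal θ.β ^ k * ∫⁻ y, ENNReal.ofReal (shock θ y) ∂ν := by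
    simp_rw [ENNReal.ofReal_mul (pow_nonneg hθ.1 k), ENNReal.ofReal_pow hθ.1]
    rw [lintegral_const_mul _ (by fun_prop), ← (measurePreserving_eval_iidLaw _).lintegral_comp
      (measurable_shock θ).ennreal_ofReal]
  simp only [shockSum]
  rw [lintegral_tsum hmeas, tsum_congr hterm, ENNReal.tsum_mul_right,
    ENNReal.tsum_geometric]
  exact ENNReal.mul_ne_top
    (ENNReal.inv_ne_top.mpr (tsub_pos_of_lt (ENNReal.ofReal_lt_one.mpr hθ.2.1)).ne') hshock

lemma ae_forall_shockSum_ne_top : ∀ᵐ z ∂(iidLaw ν), ∀ t, shockSum θ z t ≠ ∞ :=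
  ae_all_iff.mpr fun t => (ae_lt_top (measurable_shockSum θ t)
    (lintegral_shockSum_ne_top hθ hν t)).mono fun _ hz => hz.ne

lemma integrable_logVol (t : ℤ) : Integrable (fun z => logVol θ z t) (iidLaw ν) :=
  (integrable_const _).add (integrable_toReal_of_lintegral_ne_top
    (measurable_shockSum θ t).aemeasurable (lintegral_shockSum_ne_top hθ hν t))

end Canonical

namespace IsStationaryEGARCH

variable {Ω : Type*} [MeasurableSpace Ω] {P : Measure Ω} {θ : Param} {Z X σ : ℤ → Ω → ℝ}
  (h : IsStationaryEGARCH P θ Z X σ)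

include h

lemma measurable_innovations : Measurable fun ω (k : ℤ) => Z k ω :=
  measurable_pi_lambda _ h.measurable_Z

lemma map_innovations_eq_iidLaw : P.map (fun ω k => Z k ω) = iidLaw (P.map (Z 0)) := by
  rw [h.indep.map_fun_eq_infinitePi_map h.measurable_Z]
  exact congrArg _ (funext fun k => (h.identDistrib k).map_eq)

lemma ae_innovations_of_ae_iidLaw {p : (ℤ → ℝ) → Prop}
    (hp : ∀ᵐ z ∂(iidLaw (P.map (Z 0))), p z) : ∀ᵐ ω ∂P, p fun k => Z k ω := by
  rw [← h.map_innovations_eq_iidLaw] at hp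
  exact ae_of_ae_map h.measurable_innovations.aemeasurable hp

lemma memLp_id_map : MemLp id 2 (P.map (Z 0)) :=
  (memLp_map_measure_iff aestronglyMeasurable_id (h.measurable_Z 0).aemeasurable).mpr h.memLp

lemma identDistrib_log_sq (t : ℤ) :
    IdentDistrib (fun ω => Real.log (σ t ω ^ 2)) (fun ω => Real.log (σ 0 ω ^ 2)) P P := by
  have hcomp := (h.stationary t).comp (u := fun y => Real.log ((y 0).2 ^ 2))
    ((measurable_pi_apply (0 : ℤ)).snd.pow_const 2).log
  simpa only [Function.comp_def, zero_add] using hcomp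

variable [IsProbabilityMeasure P]

lemma isProbabilityMeasure_map : IsProbabilityMeasure (P.map (Z 0)) :=
  Measure.isProbabilityMeasure_map (h.measurable_Z 0).aemeasurable

lemma identDistrib_logVol (t : ℤ) : IdentDistrib (fun ω => logVol θ (fun k => Z k ω) t)
    (fun z => logVol θ z 0) P (iidLaw (P.map (Z 0))) := by
  have := h.isProbabilityMeasure_map
  have hshift : IdentDistrib (fun ω k => Z k ω) (seqShift (-t)) P (iidLaw (P.map (Z 0))) :=
    ⟨h.measurable_innovations.aemeasurable, (measurable_seqShift _).aemeasurable, by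
      rw [h.map_innovations_eq_iidLaw, (measurePreserving_seqShift _).map_eq]⟩
  simpa only [Function.comp_def, logVol_seqShift, add_neg_cancel] using
    hshift.comp (measurable_logVol θ t)

variable (hθ : θ ∈ paramSpace)

include hθ

lemma ae_log_sq_sub_logVol_eq_pow_mul (t : ℤ) : ∀ᵐ ω ∂P, ∀ n : ℕ,
    Real.log (σ t ω ^ 2) - logVol θ (fun k => Z k ω) t =
      θ.β ^ n * (Real.log (σ (t - n) ω ^ 2) - logVol θ (fun k => Z k ω) (t - n)) := by
  have := h.isProbabilityMeasure_map
  filter_upwards [ae_all_iff.mpr h.recursion, h.ae_innovations_of_ae_iidLaw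
    (ae_forall_shockSum_ne_top hθ (h.memLp_id_map.integrable one_le_two))] with ω hrec hfin n
  induction n with
  | zero => simp
  | succ n ih =>
    have hlogVol := logVol_succ hθ (hfin (t - n - 1))
    rw [sub_add_cancel] at hlogVol
    rw [ih, hrec (t - n), hlogVol, shock, Nat.cast_succ, ← sub_sub t]
    ring

lemma ae_log_sq_eq_logVol (t : ℤ) :
    ∀ᵐ ω ∂P, Real.log (σ t ω ^ 2) = logVol θ (fun k => Z k ω) t := by
  have := h.isProbabilityMeasure_map
  have hβ : Tendsto (fun n : ℕ => θ.β ^ n) atTop (𝓝 0) :=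
    tendsto_pow_atTop_nhds_zero_of_lt_one hθ.1 hθ.2.1
  have hzero := ae_eq_zero_of_eq_sub_of_tendstoInMeasure
    ((h.ae_log_sq_sub_logVol_eq_pow_mul hθ t).mono fun ω hω n => (hω n).trans (mul_sub _ _ _))
    (tendstoInMeasure_mul_zero_of_identDistrib (fun n => h.identDistrib_log_sq (t - n)) hβ)
    (tendstoInMeasure_mul_zero_of_identDistrib (fun n => h.identDistrib_logVol (t - n)) hβ)
  exact hzero.mono fun ω => sub_eq_zero.mp

theorem ae_eq_egarch : ∀ᵐ ω ∂P, (fun t => X t ω) = egarch θ fun k => Z k ω := by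
  filter_upwards [ae_all_iff.mpr (h.ae_log_sq_eq_logVol hθ), ae_all_iff.mpr h.pos,
    ae_all_iff.mpr h.eq_mul] with ω hlog hpos hmul
  funext t
  rw [hmul t, egarch, ← hlog t, Real.log_pow, Nat.cast_ofNat, mul_div_cancel_left₀ _ two_ne_zero,
    Real.exp_log (hpos t)]

end IsStationaryEGARCH

section NegativeMean

variable {S : Type*} [MeasurableSpace S] {μ : Measure S}

lemma extLog_of_pos {y : ℝ} (hy : 0 < y) : extLog y = (Real.log y : EReal) :=
  ENNReal.log_ofReal_of_pos hy

lemma ofReal_log_max_exp_neg_le (y : ℝ) (n : ℕ) :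
    ENNReal.ofReal (Real.log (max y (Real.exp (-n)))) ≤ (extLog y).toENNReal := by
  rcases le_total y (Real.exp (-n)) with hy | hy
  · rw [max_eq_right hy, Real.log_exp, ENNReal.ofReal_of_nonpos (by simp)]
    exact zero_le
  · rw [max_eq_left hy, extLog_of_pos ((Real.exp_pos _).trans_le hy), EReal.real_coe_toENNReal]

lemma ofReal_neg_log_max_exp_neg_le (y : ℝ) (n : ℕ) :
    ENNReal.ofReal (-Real.log (max y (Real.exp (-n)))) ≤ ENNReal.ofReal n := by
  have hlog := Real.log_le_log (Real.exp_pos (-n)) (le_max_right y _)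
  rw [Real.log_exp] at hlog
  exact ENNReal.ofReal_le_ofReal (by linarith)

lemma monotone_ofReal_neg_log_max_exp_neg (y : ℝ) :
    Monotone fun n : ℕ => ENNReal.ofReal (-Real.log (max y (Real.exp (-n)))) := fun _ _ hnk =>
  ENNReal.ofReal_le_ofReal (neg_le_neg (Real.log_le_log (lt_max_of_lt_right (Real.exp_pos _))
    (max_le_max_left y (Real.exp_le_exp.mpr (neg_le_neg (Nat.cast_le.mpr hnk))))))

lemma toENNReal_neg_extLog_le_iSup {y : ℝ} (hy : 0 ≤ y) : (-extLog y).toENNReal ≤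
    ⨆ n : ℕ, ENNReal.ofReal (-Real.log (max y (Real.exp (-n)))) := by
  rcases hy.eq_or_lt with rfl | hpos
  · have hlog (n : ℕ) : ENNReal.ofReal (-Real.log (max 0 (Real.exp (-n)))) = n := by
      rw [max_eq_right (Real.exp_pos _).le, Real.log_exp, neg_neg, ENNReal.ofReal_natCast]
    simp_rw [hlog, ENNReal.iSup_natCast]
    exact le_top
  · obtain ⟨n, hn⟩ := exists_nat_ge (-Real.log y)
    have hexp : Real.exp (-n) ≤ y := by
      rw [← Real.exp_log hpos]
      exact Real.exp_le_exp.mpr (by linarith)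
    refine le_iSup_of_le n ?_
    rw [max_eq_left hexp, extLog_of_pos hpos, ← EReal.coe_neg, EReal.real_coe_toENNReal]

lemma integrable_of_lintegral_ofReal_ne_top {f : S → ℝ} (hf : AEMeasurable f μ)
    (hpos : ∫⁻ x, ENNReal.ofReal (f x) ∂μ ≠ ∞) (hneg : ∫⁻ x, ENNReal.ofReal (-f x) ∂μ ≠ ∞) :
    Integrable f μ :=
  ((integrable_toReal_of_lintegral_ne_top hf.ennreal_ofReal hpos).sub
    (integrable_toReal_of_lintegral_ne_top hf.neg.ennreal_ofReal hneg)).congr <|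
      ae_of_all _ fun x => by
        simp only [Pi.sub_apply, Pi.neg_apply, ENNReal.toReal_ofReal']
        exact max_zero_sub_max_neg_zero_eq_self (f x)

lemma integral_neg_of_lintegral_ofReal_lt {f : S → ℝ} (hf : Integrable f μ)
    (hlt : ∫⁻ x, ENNReal.ofReal (f x) ∂μ < ∫⁻ x, ENNReal.ofReal (-f x) ∂μ) :
    ∫ x, f x ∂μ < 0 := by
  rw [integral_eq_lintegral_pos_part_sub_lintegral_neg_part hf, sub_neg]
  exact (ENNReal.toReal_lt_toReal hlt.ne_top hf.neg.lintegral_lt_top.ne).mpr hlt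

lemma exists_integral_log_max_neg [IsFiniteMeasure μ] {Y : S → ℝ} (hY : Measurable Y)
    (hY0 : ∀ x, 0 ≤ Y x) (h : HasNegativeMean μ fun x => extLog (Y x)) :
    ∃ r : ℝ, 0 < r ∧ Integrable (fun x => Real.log (max (Y x) r)) μ ∧
      ∫ x, Real.log (max (Y x) r) ∂μ < 0 := by
  have hmeas (n : ℕ) : Measurable fun x => Real.log (max (Y x) (Real.exp (-n))) :=
    (hY.max measurable_const).log
  have hmeas_neg (n : ℕ) : Measurable fun x =>
      ENNReal.ofReal (-Real.log (max (Y x) (Real.exp (-n)))) := (hmeas n).neg.ennreal_ofReal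
  have hlt : ∫⁻ x, (extLog (Y x)).toENNReal ∂μ <
      ⨆ n : ℕ, ∫⁻ x, ENNReal.ofReal (-Real.log (max (Y x) (Real.exp (-n)))) ∂μ := by
    rw [← lintegral_iSup hmeas_neg fun _ _ hnk x => monotone_ofReal_neg_log_max_exp_neg (Y x) hnk]
    exact h.trans_le (lintegral_mono fun x => toENNReal_neg_extLog_le_iSup (hY0 x))
  obtain ⟨n, hn⟩ := lt_iSup_iff.mp hlt
  have hlt_n := (lintegral_mono fun x => ofReal_log_max_exp_neg_le (Y x) n).trans_lt hn
  have hneg : ∫⁻ x, ENNReal.ofReal (-Real.log (max (Y x) (Real.exp (-n)))) ∂μ ≠ ∞ :=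
    ((lintegral_mono fun x => ofReal_neg_log_max_exp_neg_le (Y x) n).trans_lt
      (lintegral_const_lt_top ENNReal.ofReal_ne_top)).ne
  have hint := integrable_of_lintegral_ofReal_ne_top (hmeas n).aemeasurable hlt_n.ne_top hneg
  exact ⟨Real.exp (-n), Real.exp_pos _, hint, integral_neg_of_lintegral_ofReal_lt hint hlt_n⟩

lemma exists_ae_eventually_prod_le [IsProbabilityMeasure μ] {T : S → S} (hT : Ergodic T μ)
    {Y : S → ℝ} (hY : Measurable Y) (hY0 : ∀ x, 0 ≤ Y x)
    (h : HasNegativeMean μ fun x => extLog (Y x)) :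
    ∃ c < (0 : ℝ), ∀ᵐ x ∂μ, ∀ᶠ n : ℕ in atTop,
      ∏ j ∈ Finset.range n, Y (T^[j] x) ≤ Real.exp c ^ n := by
  obtain ⟨r, hr, hint, hneg⟩ := exists_integral_log_max_neg hY hY0 h
  obtain ⟨c, hc, hc0⟩ := exists_between hneg
  refine ⟨c, hc0, ?_⟩
  filter_upwards [ae_eventually_birkhoffSum_le hT (hY.max measurable_const).log hint hc] with x hx
  filter_upwards [hx] with n hn
  calc ∏ j ∈ Finset.range n, Y (T^[j] x)
      ≤ ∏ j ∈ Finset.range n, Real.exp (Real.log (max (Y (T^[j] x)) r)) :=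
        Finset.prod_le_prod (fun _ _ => hY0 _) fun j _ => by
          rw [Real.exp_log (lt_max_of_lt_right hr)]
          exact le_max_left _ _
    _ = Real.exp (birkhoffSum T (fun x => Real.log (max (Y x) r)) n x) := by
        rw [birkhoffSum, Real.exp_sum]
    _ ≤ Real.exp c ^ n := by
        rw [← Real.exp_nat_mul, mul_comm]
        exact Real.exp_le_exp.mpr hn

end NegativeMean

section Contraction

lemma backIter_seqShift (x : ℤ → ℝ) (θ : Param) (s : ℤ) (n : ℕ) (t : ℤ) :
    backIter (seqShift s x) θ n t = backIter x θ n (t + s) := by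
  induction n generalizing t with
  | zero => rfl
  | succ n ih => rw [backIter, backIter, ih, seqShift, sub_add_eq_add_sub]

lemma seqShift_egarch (θ : Param) (z : ℤ → ℝ) (s : ℤ) :
    seqShift s (egarch θ z) = egarch θ (seqShift s z) :=
  funext fun t => (egarch_seqShift θ z s t).symm

lemma statLog_egarch_seqShift (θ₀ θ : Param) (z : ℤ → ℝ) (s t : ℤ) :
    statLog (egarch θ₀ (seqShift s z)) θ t = statLog (egarch θ₀ z) θ (t + s) := by
  simp only [← seqShift_egarch, statLog, backIter_seqShift]

lemma dependsOn_backIter (θ : Param) (n : ℕ) (t : ℤ) :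
    DependsOn (fun x => backIter x θ n t) (Set.Iio t) := by
  induction n generalizing t with
  | zero => exact fun _ _ _ => rfl
  | succ n ih =>
    intro x y hxy
    have hprev : backIter x θ n (t - 1) = backIter y θ n (t - 1) :=
      ih (t - 1) fun k hk => hxy k (lt_trans hk (sub_one_lt t))
    simp only [backIter, hxy (t - 1) (sub_one_lt t), hprev]

lemma dependsOn_statLog (θ : Param) (t : ℤ) :
    DependsOn (fun x => statLog x θ t) (Set.Iio t) := fun _ _ hxy =>
  congrArg (fun u : ℕ → ℝ => limsup u atTop) (funext fun n => dependsOn_backIter θ n t hxy)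

lemma dependsOn_statLog_egarch (θ₀ θ : Param) (t : ℤ) :
    DependsOn (fun z => statLog (egarch θ₀ z) θ t) (Set.Iio t) := fun _ _ hzw =>
  dependsOn_statLog θ t fun k hk => dependsOn_egarch θ₀ k fun i hi =>
    hzw i (Set.mem_Iio.mpr (lt_of_le_of_lt hi hk))

lemma measurable_backIter_egarch (θ₀ θ : Param) (n : ℕ) (t : ℤ) :
    Measurable fun z => backIter (egarch θ₀ z) θ n t := by
  induction n generalizing t with
  | zero => exact measurable_const
  | succ n ih =>
    have hprev := ih (t - 1)
    have hobs := measurable_egarch θ₀ (t - 1)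
    simp only [backIter, logStep, shock]
    fun_prop

lemma measurable_statLog_egarch (θ₀ θ : Param) (t : ℤ) :
    Measurable fun z => statLog (egarch θ₀ z) θ t :=
  Measurable.limsup fun n => measurable_backIter_egarch θ₀ θ n t

variable {ν : Measure ℝ} [IsProbabilityMeasure ν] {θ₀ : Param} {K : Set Param}
  (hK : IsCompact K) (hKΘ : K ⊆ paramSpace) (hθ₀ : θ₀ ∈ K)
  (hlam : HasNegativeMean (iidLaw ν) fun z => extLog (lipSup K (egarch θ₀ z 0)))

include hK hθ₀ hlam

lemma exists_ae_eventually_prod_lipSup_le {s : ℤ} (hs : s ≠ 0) :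
    ∃ c < (0 : ℝ), ∀ᵐ z ∂(iidLaw ν), ∀ᶠ n : ℕ in atTop,
      ∏ j ∈ Finset.range n, lipSup K (egarch θ₀ z (j * s)) ≤ Real.exp c ^ n := by
  simpa only [seqShift_iterate, egarch_seqShift, zero_add, Function.comp_apply] using
    exists_ae_eventually_prod_le (ergodic_seqShift hs)
      ((measurable_lipSup hK ⟨θ₀, hθ₀⟩).comp (measurable_egarch θ₀ 0))
      (fun _ => lipSup_nonneg _) hlam

theorem ae_isContractive : ∀ᵐ z ∂(iidLaw ν), IsContractive K (egarch θ₀ z) := by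
  obtain ⟨c, hc, hforw⟩ := exists_ae_eventually_prod_lipSup_le hK hθ₀ hlam one_ne_zero
  obtain ⟨d, hd, hback⟩ :=
    exists_ae_eventually_prod_lipSup_le hK hθ₀ hlam (neg_ne_zero.mpr one_ne_zero)
  filter_upwards [hforw, ae_forall_seqShift hback] with z hzforw hzback
  refine ⟨fun t => ?_, ?_⟩
  · refine Summable.of_norm_bounded_eventually_nat
      (summable_geometric_of_lt_one (Real.exp_pos d).le (Real.exp_lt_one_iff.mpr hd)) ?_
    filter_upwards [hzback (t - 1)] with n hn
    have hidx (j : ℕ) : (j : ℤ) * -1 + (t - 1) = t - 1 - j := by ring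
    simp only [egarch_seqShift, hidx] at hn
    rwa [backProd, Real.norm_of_nonneg (Finset.prod_nonneg fun _ _ => lipSup_nonneg _)]
  · refine squeeze_zero' (Eventually.of_forall fun n =>
      Finset.prod_nonneg fun _ _ => lipSup_nonneg _) ?_
      (tendsto_pow_atTop_nhds_zero_of_lt_one (Real.exp_pos c).le (Real.exp_lt_one_iff.mpr hc))
    filter_upwards [hzforw] with n hn
    simpa only [forwProd, mul_one] using hn

variable (hν : Integrable id ν)

include hKΘ hν

lemma ae_tendsto_statLog_sub_logVol : ∀ᵐ z ∂(iidLaw ν),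
    Tendsto (fun n : ℕ => statLog (egarch θ₀ z) θ₀ n - logVol θ₀ z n) atTop (𝓝 0) := by
  filter_upwards [ae_isContractive hK hθ₀ hlam, ae_forall_shockSum_ne_top (hKΘ hθ₀) hν]
    with z hz hfin
  have hbound (n : ℕ) := abs_sub_le_prod_mul_of_logStep hK hKΘ (x := fun n => egarch θ₀ z n)
    (u := fun n => statLog (egarch θ₀ z) θ₀ n) (v := fun n => logVol θ₀ z n) (ε := 0)
    hθ₀ (fun _ => le_rfl) (fun n => by exact_mod_cast statLog_succ hK hKΘ hz hθ₀ n)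
    (fun n => by exact_mod_cast logVol_succ_eq_logStep (hKΘ hθ₀) (hfin n))
    (fun n => by simpa using lowerBound_le_statLog hK hKΘ hz hθ₀ n)
    (fun n => by
      simpa using (lowerBound_le_baseLevel hK hKΘ hθ₀).trans (baseLevel_le_logVol θ₀ z n)) n
  simp only [Pi.zero_apply, Real.exp_zero, one_mul] at hbound
  refine squeeze_zero_norm hbound ?_
  simpa only [zero_mul, forwProd] using hz.tendsto_forwProd.mul_const _

theorem ae_statLog_eq_logVol :
    ∀ᵐ z ∂(iidLaw ν), ∀ t, statLog (egarch θ₀ z) θ₀ t = logVol θ₀ z t := by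
  have hzero : (fun z => statLog (egarch θ₀ z) θ₀ 0 - logVol θ₀ z 0) =ᵐ[iidLaw ν] 0 := by
    refine ae_eq_zero_of_ae_tendsto_comp (T := fun n : ℕ => seqShift n)
      ((measurable_statLog_egarch θ₀ θ₀ 0).sub (measurable_logVol θ₀ 0))
      (fun n => measurePreserving_seqShift n) ?_
    simpa only [statLog_egarch_seqShift, logVol_seqShift, zero_add] using
      ae_tendsto_statLog_sub_logVol hK hKΘ hθ₀ hlam hν
  filter_upwards [ae_forall_seqShift hzero] with z hz t
  simpa only [statLog_egarch_seqShift, logVol_seqShift, zero_add, Pi.zero_apply, sub_eq_zero]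
    using hz t

end Contraction

section Independence

variable {ι : Type*} {E : ι → Type*} [∀ i, MeasurableSpace (E i)] {F : Type*} [MeasurableSpace F]

lemma measurable_cylinderEvents_of_dependsOn [Nonempty (∀ i, E i)] {u : (∀ i, E i) → F}
    (hu : Measurable u) {s : Set ι} (hs : DependsOn u s) : Measurable[cylinderEvents s] u := by
  classical
  obtain ⟨e⟩ := ‹Nonempty (∀ i, E i)›
  have hproj : Measurable[cylinderEvents s] fun (z : ∀ i, E i) i => if i ∈ s then z i else e i := by
    refine @measurable_pi_lambda _ _ _ (cylinderEvents s) _ _ fun i => ?_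
    by_cases hi : i ∈ s
    · simpa only [hi, if_true] using measurable_cylinderEvent_apply hi
    · simpa only [hi, if_false] using @measurable_const _ _ _ (cylinderEvents s) (e i)
  have hfactor : u = u ∘ fun z i => if i ∈ s then z i else e i :=
    funext fun z => hs fun i hi => (if_pos hi).symm
  rw [hfactor]
  exact hu.comp hproj

lemma indepFun_eval_of_dependsOn {μ : ∀ i, Measure (E i)} [∀ i, IsProbabilityMeasure (μ i)]
    {u : (∀ i, E i) → F} (hu : Measurable u) {s : Set ι} (hs : DependsOn u s) {i : ι}
    (hi : i ∉ s) : IndepFun u (fun z => z i) (Measure.infinitePi μ) := by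
  have : ∀ i, Nonempty (E i) := fun i => nonempty_of_isProbabilityMeasure (μ i)
  have hindep : Indep (cylinderEvents s) (cylinderEvents {i}) (Measure.infinitePi μ) :=
    indep_iSup_of_disjoint (fun k => (measurable_pi_apply k).comap_le)
      (iIndepFun_infinitePi (X := fun _ x => x) fun _ => measurable_id)
      (Set.disjoint_singleton_right.mpr hi)
  rw [IndepFun_iff_Indep]
  exact indep_of_indep_of_le_right
    (indep_of_indep_of_le_left hindep (measurable_cylinderEvents_of_dependsOn hu hs).comap_le)
    (measurable_cylinderEvent_apply (Set.mem_singleton i)).comap_le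

lemma exists_ae_eq_const_of_indepFun {S : Type*} [MeasurableSpace S] {μ : Measure S}
    [IsProbabilityMeasure μ] {U V : S → ℝ} (hU : Measurable U) (hV : Measurable V)
    (h : IndepFun U V μ) (hsum : ∀ᵐ x ∂μ, U x + V x = 0) : ∃ c, ∀ᵐ x ∂μ, V x = c := by
  have : IsProbabilityMeasure (μ.map U) := Measure.isProbabilityMeasure_map hU.aemeasurable
  have : IsProbabilityMeasure (μ.map V) := Measure.isProbabilityMeasure_map hV.aemeasurable
  have hsum_prod : ∀ᵐ p ∂((μ.map U).prod (μ.map V)), p.1 + p.2 = 0 := by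
    rw [← (indepFun_iff_map_prod_eq_prod_map_map hU.aemeasurable hV.aemeasurable).mp h]
    exact (ae_map_iff (hU.prodMk hV).aemeasurable
      (measurableSet_eq_fun (by fun_prop) measurable_const)).mpr hsum
  obtain ⟨u, hu⟩ := (Measure.ae_ae_of_ae_prod hsum_prod).exists
  exact ⟨-u, (ae_of_ae_map hV.aemeasurable hu).mono fun x hx => eq_neg_of_add_eq_zero_right hx⟩

end Independence

section Identification

lemma frequently_ae_pos_of_integral_eq_zero {S : Type*} [MeasurableSpace S] {μ : Measure S}
    {f : S → ℝ} (hf : Integrable f μ) (hmean : ∫ x, f x ∂μ = 0) (hne : ¬ f =ᵐ[μ] 0) :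
    ∃ᵐ x ∂μ, 0 < f x := by
  intro hpos
  have hnonpos : 0 ≤ᵐ[μ] -f := hpos.mono fun x hx => neg_nonneg.mpr (not_lt.mp hx)
  have hzero := (integral_eq_zero_iff_of_nonneg_ae hnonpos hf.neg).mp
    (by simp only [Pi.neg_apply, integral_neg, hmean, neg_zero])
  exact hne (hzero.mono fun x hx => neg_eq_zero.mp hx)

variable {ν : Measure ℝ} (hν : Integrable id ν) (hmean : ∫ y, y ∂ν = 0)
  (hndeg : ∀ a b : ℝ, ¬ ∀ᵐ y ∂ν, y = a ∨ y = b)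

include hν hmean hndeg

lemma γ_eq_zero_and_δ_eq_zero_of_ae_shock_eq_const {θ : Param} {c : ℝ}
    (h : ∀ᵐ y ∂ν, shock θ y = c) : θ.γ = 0 ∧ θ.δ = 0 := by
  have hne : ¬ id =ᵐ[ν] (0 : ℝ → ℝ) := fun hzero => hndeg 0 0 (hzero.mono fun y hy => Or.inl hy)
  have hne_neg : ¬ (fun y : ℝ => -y) =ᵐ[ν] 0 := fun hzero =>
    hne (hzero.mono fun y hy => neg_eq_zero.mp hy)
  obtain ⟨y, hy, hcy⟩ := ((frequently_ae_pos_of_integral_eq_zero hν hmean hne).and_eventually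
    h).exists
  obtain ⟨w, hw, hcw⟩ := ((frequently_ae_pos_of_integral_eq_zero (f := fun y => -y) hν.neg
    (by rw [integral_neg, hmean, neg_zero]) hne_neg).and_eventually h).exists
  have hpos {x : ℝ} (hx : 0 < x) : shock θ x = (θ.γ + θ.δ) * x := by
    rw [shock, abs_of_pos hx]; ring
  have hneg {x : ℝ} (hx : x < 0) : shock θ x = (θ.γ - θ.δ) * x := by
    rw [shock, abs_of_neg hx]; ring
  replace hy : 0 < y := hy
  replace hw : w < 0 := neg_pos.mp hw
  rw [hpos hy] at hcy
  rw [hneg hw] at hcw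
  by_cases hc : c = 0
  · rw [hc] at hcy hcw
    have hadd := (mul_eq_zero.mp hcy).resolve_right hy.ne'
    have hsub := (mul_eq_zero.mp hcw).resolve_right hw.ne
    constructor <;> linarith
  · have hadd : θ.γ + θ.δ ≠ 0 := left_ne_zero_of_mul (hcy.trans_ne hc)
    have hsub : θ.γ - θ.δ ≠ 0 := left_ne_zero_of_mul (hcw.trans_ne hc)
    refine absurd (h.mono fun x hx => ?_) (hndeg (c / (θ.γ + θ.δ)) (c / (θ.γ - θ.δ)))
    rw [eq_div_iff hadd, eq_div_iff hsub, mul_comm x, mul_comm x]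
    rcases lt_trichotomy x 0 with hx0 | rfl | hx0
    · exact Or.inr ((hneg hx0).symm.trans hx)
    · exact absurd hx.symm (by simpa [shock] using hc)
    · exact Or.inl ((hpos hx0).symm.trans hx)

variable [IsProbabilityMeasure ν]

lemma γ_eq_zero_and_δ_eq_zero_of_ae_shock_eval_eq_const {θ : Param} {c : ℝ}
    (h : ∀ᵐ z ∂(iidLaw ν), shock θ (z 0) = c) : θ.γ = 0 ∧ θ.δ = 0 := by
  refine γ_eq_zero_and_δ_eq_zero_of_ae_shock_eq_const hν hmean hndeg (c := c) ?_
  have hpres := measurePreserving_eval_iidLaw (ν := ν) 0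
  rw [← hpres.map_eq]
  exact (ae_map_iff hpres.measurable.aemeasurable
    (measurableSet_eq_fun (measurable_shock θ) measurable_const)).mpr h

lemma not_ae_logVol_eq_const {θ : Param} (hθ : θ ∈ paramSpace) (hγδ : (θ.γ, θ.δ) ≠ (0, 0))
    (c : ℝ) : ¬ ∀ᵐ z ∂(iidLaw ν), logVol θ z 0 = c := by
  intro hconst
  have hshock : ∀ᵐ z ∂(iidLaw ν), shock θ (z 0) = c - θ.α - θ.β * c := by
    filter_upwards [ae_forall_seqShift hconst, ae_forall_shockSum_ne_top hθ hν] with z hz hfin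
    simp only [logVol_seqShift, zero_add] at hz
    have hsucc := logVol_succ hθ (hfin 0)
    rw [hz, hz] at hsucc
    linarith
  obtain ⟨hγ, hδ⟩ := γ_eq_zero_and_δ_eq_zero_of_ae_shock_eval_eq_const hν hmean hndeg hshock
  exact hγδ (Prod.ext hγ hδ)

variable {θ₀ θ : Param} {K : Set Param} (hK : IsCompact K) (hKΘ : K ⊆ paramSpace) (hθ₀ : θ₀ ∈ K)
  (hlam : HasNegativeMean (iidLaw ν) fun z => extLog (lipSup K (egarch θ₀ z 0)))

include hK hKΘ hθ₀ hlam

omit hmean hndeg in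
lemma ae_affine_logVol_add_shock_eq_zero (hθ : θ ∈ K)
    (h : ∀ᵐ z ∂(iidLaw ν), statLog (egarch θ₀ z) θ 0 = logVol θ₀ z 0) : ∀ᵐ z ∂(iidLaw ν),
      ((θ - θ₀).β * logVol θ₀ z 0 + (θ - θ₀).α) + shock (θ - θ₀) (z 0) = 0 := by
  filter_upwards [ae_forall_shockSum_ne_top (hKΘ hθ₀) hν, ae_forall_seqShift h,
    ae_isContractive hK hθ₀ hlam] with z hfin hz hcontr
  simp only [statLog_egarch_seqShift, logVol_seqShift, zero_add] at hz
  have hstep₀ := logVol_succ (hKΘ hθ₀) (hfin 0)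
  have hstep := statLog_succ hK hKΘ hcontr hθ 0
  rw [hz, hz, hstep₀, logStep, shock_egarch_mul_exp] at hstep
  simp only [shock, PiLp.sub_apply] at hstep ⊢
  linear_combination -hstep

theorem eq_of_ae_statLog_eq_logVol (hγδ : (θ₀.γ, θ₀.δ) ≠ (0, 0)) (hθ : θ ∈ K)
    (h : ∀ᵐ z ∂(iidLaw ν), statLog (egarch θ₀ z) θ 0 = logVol θ₀ z 0) : θ = θ₀ := by
  have hzero := ae_affine_logVol_add_shock_eq_zero hν hK hKΘ hθ₀ hlam hθ h
  have hindep : IndepFun (fun z => (θ - θ₀).β * logVol θ₀ z 0 + (θ - θ₀).α)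
      (fun z => shock (θ - θ₀) (z 0)) (iidLaw ν) :=
    (indepFun_eval_of_dependsOn (measurable_logVol θ₀ 0) (dependsOn_logVol θ₀ 0)
      Set.self_notMem_Iio).comp (φ := fun l => (θ - θ₀).β * l + (θ - θ₀).α)
        ((measurable_id.const_mul _).add_const _) (measurable_shock (θ - θ₀))
  obtain ⟨c, hc⟩ := exists_ae_eq_const_of_indepFun
    (((measurable_logVol θ₀ 0).const_mul _).add_const _)
    ((measurable_shock _).comp (measurable_pi_apply 0)) hindep hzero
  obtain ⟨hγ, hδ⟩ := γ_eq_zero_and_δ_eq_zero_of_ae_shock_eval_eq_const hν hmean hndeg hc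
  simp only [shock, hγ, hδ, zero_mul, add_zero] at hzero
  have hβ : (θ - θ₀).β = 0 := by
    by_contra hne
    refine not_ae_logVol_eq_const hν hmean hndeg (hKΘ hθ₀) hγδ (-(θ - θ₀).α / (θ - θ₀).β)
      (hzero.mono fun z hz => ?_)
    rw [eq_div_iff hne, mul_comm]
    exact eq_neg_of_add_eq_zero_left hz
  have hα : (θ - θ₀).α = 0 := by
    obtain ⟨z, hz⟩ := hzero.exists
    rwa [hβ, zero_mul, zero_add] at hz
  refine sub_eq_zero.mp (PiLp.ext fun i => ?_)
  fin_cases i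
  exacts [hα, hβ, hγ, hδ]

end Identification

section Likelihood

lemma lintegral_mul_add_eq_of_indepFun {S : Type*} [MeasurableSpace S] {μ : Measure S}
    {u v w : S → ℝ≥0∞} (hu : Measurable u) (hw : Measurable w) (h : IndepFun u w μ)
    (hw1 : ∫⁻ x, w x ∂μ = 1) : ∫⁻ x, (u x * w x + v x) ∂μ = ∫⁻ x, (u x + v x) ∂μ := by
  have hprod := lintegral_mul_eq_lintegral_mul_lintegral_of_indepFun hu hw h
  rw [hw1, mul_one] at hprod
  rw [lintegral_add_left hu, lintegral_add_left (f := fun x => u x * w x) (hu.mul hw), ← hprod]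
  rfl

/-- The summand `X_t² / h_t + log h_t` of minus twice the stationary quasi-log-likelihood, in which
the volatility is computed from the infinite past of the data `x`. -/
noncomputable def statContrast (x : ℤ → ℝ) (θ : Param) (t : ℤ) : ℝ :=
  contrast (x t) (statLog x θ t)

lemma statContrast_egarch_seqShift (θ₀ θ : Param) (z : ℤ → ℝ) (s t : ℤ) :
    statContrast (egarch θ₀ (seqShift s z)) θ t = statContrast (egarch θ₀ z) θ (t + s) := by
  rw [statContrast, statContrast, statLog_egarch_seqShift, egarch_seqShift]

lemma measurable_statContrast_egarch (θ₀ θ : Param) (t : ℤ) :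
    Measurable fun z => statContrast (egarch θ₀ z) θ t := by
  have hobs := measurable_egarch θ₀ t
  have hlog := measurable_statLog_egarch θ₀ θ t
  unfold statContrast contrast
  fun_prop

lemma contrast_egarch (θ : Param) (z : ℤ → ℝ) (t : ℤ) (l : ℝ) :
    contrast (egarch θ z t) l = Real.exp (logVol θ z t - l) * z t ^ 2 + l := by
  rw [contrast, egarch, mul_pow, ← Real.exp_nat_mul, Nat.cast_ofNat, mul_div_cancel₀ _ two_ne_zero,
    sub_eq_add_neg, Real.exp_add]
  ring

variable {θ₀ θ : Param} {K : Set Param} (hK : IsCompact K) (hKΘ : K ⊆ paramSpace)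

include hK hKΘ in
lemma continuousOn_statContrast {x : ℤ → ℝ} (hx : IsContractive K x) (t : ℤ) :
    ContinuousOn (fun θ => statContrast x θ t) K := by
  have hlog := continuousOn_statLog hK hKΘ hx t
  unfold statContrast contrast
  fun_prop

variable {ν : Measure ℝ} [IsProbabilityMeasure ν] (hvar : ∫ y, y ^ 2 ∂ν = 1)

include hvar

lemma integral_eval_sq (t : ℤ) : ∫ z, z t ^ 2 ∂(iidLaw ν) = 1 := by
  have hmap := integral_map (μ := iidLaw ν) (f := fun y : ℝ => y ^ 2)
    (measurable_pi_apply t).aemeasurable (by fun_prop)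
  rwa [(measurePreserving_eval_iidLaw t).map_eq, hvar, eq_comm] at hmap

lemma integrable_eval_sq (t : ℤ) : Integrable (fun z : ℤ → ℝ => z t ^ 2) (iidLaw ν) :=
  .of_integral_ne_zero ((integral_eval_sq hvar t).trans_ne one_ne_zero)

lemma lintegral_ofReal_eval_sq (t : ℤ) :
    ∫⁻ z, ENNReal.ofReal (z t ^ 2) ∂(iidLaw ν) = 1 := by
  rw [← ofReal_integral_eq_lintegral_ofReal (integrable_eval_sq hvar t)
    (ae_of_all _ fun _ => sq_nonneg _), integral_eval_sq hvar t, ENNReal.ofReal_one]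

variable (hθ₀ : θ₀ ∈ K)
  (hlam : HasNegativeMean (iidLaw ν) fun z => extLog (lipSup K (egarch θ₀ z 0)))

include hK hKΘ hθ₀ hlam

lemma lintegral_statContrast_sub_lowerBound (hθ : θ ∈ K) :
    ∫⁻ z, ENNReal.ofReal (statContrast (egarch θ₀ z) θ 0 - lowerBound K) ∂(iidLaw ν) =
      ∫⁻ z, ENNReal.ofReal (Real.exp (logVol θ₀ z 0 - statLog (egarch θ₀ z) θ 0) +
        (statLog (egarch θ₀ z) θ 0 - lowerBound K)) ∂(iidLaw ν) := by
  have hmeas : Measurable fun z => logVol θ₀ z 0 - statLog (egarch θ₀ z) θ 0 :=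
    (measurable_logVol θ₀ 0).sub (measurable_statLog_egarch θ₀ θ 0)
  have hdep : DependsOn (fun z => logVol θ₀ z 0 - statLog (egarch θ₀ z) θ 0) (Set.Iio 0) :=
    fun _ _ hzw => congrArg₂ (· - ·) (dependsOn_logVol θ₀ 0 hzw)
      (dependsOn_statLog_egarch θ₀ θ 0 hzw)
  have hindep : IndepFun
      (fun z => ENNReal.ofReal (Real.exp (logVol θ₀ z 0 - statLog (egarch θ₀ z) θ 0)))
      (fun z => ENNReal.ofReal (z 0 ^ 2)) (iidLaw ν) :=
    (indepFun_eval_of_dependsOn hmeas hdep Set.self_notMem_Iio).comp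
      (φ := fun u => ENNReal.ofReal (Real.exp u)) (ψ := fun y => ENNReal.ofReal (y ^ 2))
      (by fun_prop) (by fun_prop)
  have hnonneg : ∀ᵐ z ∂(iidLaw ν), 0 ≤ statLog (egarch θ₀ z) θ 0 - lowerBound K :=
    (ae_isContractive hK hθ₀ hlam).mono fun z hz =>
      sub_nonneg.mpr (lowerBound_le_statLog hK hKΘ hz hθ 0)
  calc ∫⁻ z, ENNReal.ofReal (statContrast (egarch θ₀ z) θ 0 - lowerBound K) ∂(iidLaw ν)
      = ∫⁻ z, (ENNReal.ofReal (Real.exp (logVol θ₀ z 0 - statLog (egarch θ₀ z) θ 0)) *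
          ENNReal.ofReal (z 0 ^ 2) +
          ENNReal.ofReal (statLog (egarch θ₀ z) θ 0 - lowerBound K)) ∂(iidLaw ν) := by
        refine lintegral_congr_ae (hnonneg.mono fun z hz => ?_)
        beta_reduce
        rw [← ENNReal.ofReal_mul (Real.exp_pos _).le, ← ENNReal.ofReal_add (by positivity) hz,
          statContrast, contrast_egarch, add_sub_assoc]
    _ = _ := lintegral_mul_add_eq_of_indepFun hmeas.exp.ennreal_ofReal (by fun_prop) hindep
        (lintegral_ofReal_eval_sq hvar 0)
    _ = _ := lintegral_congr_ae (hnonneg.mono fun z hz =>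
        (ENNReal.ofReal_add (Real.exp_pos _).le hz).symm)

-- `exp u ≥ u + 1` with equality only at `u = 0`, applied to the difference of the log-volatilities.
theorem lt_lintegral_statContrast_sub_lowerBound (hν : Integrable id ν) (hmean : ∫ y, y ∂ν = 0)
    (hndeg : ∀ a b : ℝ, ¬ ∀ᵐ y ∂ν, y = a ∨ y = b) (hγδ : (θ₀.γ, θ₀.δ) ≠ (0, 0)) (hθ : θ ∈ K)
    (hne : θ ≠ θ₀) : ENNReal.ofReal (1 + ∫ z, logVol θ₀ z 0 ∂(iidLaw ν) - lowerBound K) <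
      ∫⁻ z, ENNReal.ofReal (statContrast (egarch θ₀ z) θ 0 - lowerBound K) ∂(iidLaw ν) := by
  have hlogVol := integrable_logVol (hKΘ hθ₀) hν 0
  have hsum : Integrable (fun z => 1 + logVol θ₀ z 0) (iidLaw ν) :=
    (integrable_const 1).add hlogVol
  have hint : Integrable (fun z => 1 + logVol θ₀ z 0 - lowerBound K) (iidLaw ν) :=
    hsum.sub (integrable_const _)
  have hpos (z : ℤ → ℝ) : 0 < 1 + logVol θ₀ z 0 - lowerBound K := by
    linarith [lowerBound_le_baseLevel hK hKΘ hθ₀, baseLevel_le_logVol θ₀ z 0]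
  have hmeasL := measurable_logVol θ₀ 0
  have hmeasl := measurable_statLog_egarch θ₀ θ 0
  have hfreq : ∃ᵐ z ∂(iidLaw ν), statLog (egarch θ₀ z) θ 0 ≠ logVol θ₀ z 0 := fun heq =>
    hne (eq_of_ae_statLog_eq_logVol hν hmean hndeg hK hKΘ hθ₀ hlam hγδ hθ
      (heq.mono fun _ => not_not.mp))
  have hvalue : ∫ z, (1 + logVol θ₀ z 0 - lowerBound K) ∂(iidLaw ν) =
      1 + ∫ z, logVol θ₀ z 0 ∂(iidLaw ν) - lowerBound K := by
    rw [integral_sub hsum (integrable_const _), integral_add (integrable_const 1) hlogVol]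
    simp
  rw [lintegral_statContrast_sub_lowerBound hK hKΘ hvar hθ₀ hlam hθ, ← hvalue,
    ofReal_integral_eq_lintegral_ofReal hint (ae_of_all _ fun z => (hpos z).le)]
  refine lintegral_strict_mono_of_ae_le_of_frequently_ae_lt (by fun_prop) hint.lintegral_lt_top.ne
    (ae_of_all _ fun z => ENNReal.ofReal_le_ofReal ?_) (hfreq.mono fun z hz => ?_)
  · linarith [Real.add_one_le_exp (logVol θ₀ z 0 - statLog (egarch θ₀ z) θ 0)]
  · have hexp := Real.add_one_lt_exp (sub_ne_zero.mpr hz.symm)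
    refine (ENNReal.ofReal_lt_ofReal_iff_of_nonneg (hpos z).le).mpr ?_ |>.ne
    linarith

end Likelihood

section BoundedMinorant

variable {S Y : Type*} [PseudoMetricSpace Y] [TopologicalSpace.SeparableSpace Y]

/-- The infimum of `φ` over the ball of radius `1 / (k + 1)` about `y₀`, truncated at `k`. It is
taken over a dense sequence, which keeps it measurable in parameters of `φ` and does not change it
for continuous `φ`. -/
noncomputable def truncBallInf [Nonempty Y] (φ : Y → ℝ≥0∞) (y₀ : Y) (k : ℕ) : ℝ≥0∞ :=
  min k (⨅ (j) (_ : dist (TopologicalSpace.denseSeq Y j) y₀ < 1 / ((k : ℝ) + 1)),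
    φ (TopologicalSpace.denseSeq Y j))

lemma truncBallInf_le_of_dist_lt [Nonempty Y] {φ : Y → ℝ≥0∞} (hφ : Continuous φ) {y y₀ : Y} {k : ℕ}
    (hy : dist y y₀ < 1 / ((k : ℝ) + 1)) : truncBallInf φ y₀ k ≤ φ y := by
  by_contra! hlt
  have hopen : IsOpen {w | dist w y₀ < 1 / ((k : ℝ) + 1) ∧ φ w < truncBallInf φ y₀ k} :=
    (isOpen_lt (continuous_id.dist continuous_const) continuous_const).inter
      (isOpen_lt hφ continuous_const)
  obtain ⟨j, hj, hφj⟩ := (TopologicalSpace.denseRange_denseSeq Y).exists_mem_open hopen ⟨y, hy, hlt⟩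
  exact hφj.not_ge ((min_le_right _ _).trans (iInf₂_le j hj))

lemma le_liminf_truncBallInf [Nonempty Y] {φ : Y → ℝ≥0∞} (hφ : Continuous φ) (y₀ : Y) :
    φ y₀ ≤ liminf (truncBallInf φ y₀) atTop := by
  refine le_of_forall_lt fun a ha => ?_
  obtain ⟨b, hab, hb⟩ := exists_between ha
  refine hab.trans_le (le_liminf_of_le (by isBoundedDefault) ?_)
  obtain ⟨ε, hε, hball⟩ := Metric.mem_nhds_iff.mp ((hφ.tendsto y₀).eventually_const_lt hb)
  obtain ⟨N, hN⟩ := ENNReal.exists_nat_gt (hb.trans_le le_top).ne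
  filter_upwards [eventually_ge_atTop N,
    tendsto_one_div_add_atTop_nhds_zero_nat.eventually_lt_const hε] with k hk hkε
  exact le_min (hN.le.trans (Nat.cast_le.mpr hk)) (le_iInf₂ fun j hj =>
    (hball (Metric.mem_ball.mpr (hj.trans hkε))).le)

variable [MeasurableSpace S] {μ : Measure S}

lemma measurable_truncBallInf [Nonempty Y] {φ : S → Y → ℝ≥0∞}
    (hφ : ∀ y, Measurable fun z => φ z y) (y₀ : Y) (k : ℕ) :
    Measurable fun z => truncBallInf (φ z) y₀ k :=
  measurable_const.min (Measurable.iInf fun _ => Measurable.iInf_Prop _ (hφ _))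

lemma exists_truncBallInf_lt_lintegral [Nonempty Y] {φ : S → Y → ℝ≥0∞}
    (hφ : ∀ y, Measurable fun z => φ z y) (hc : ∀ᵐ z ∂μ, Continuous (φ z)) {y₀ : Y} {c : ℝ≥0∞}
    (h : c < ∫⁻ z, φ z y₀ ∂μ) : ∃ k, c < ∫⁻ z, truncBallInf (φ z) y₀ k ∂μ := by
  have hfatou := lintegral_liminf_le (μ := μ) (u := atTop) (measurable_truncBallInf hφ y₀)
  have hle := lintegral_mono_ae (hc.mono fun z hz => le_liminf_truncBallInf hz y₀)
  exact (eventually_lt_of_lt_liminf (h.trans_le (hle.trans hfatou))).exists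

theorem exists_bounded_minorant_lt_integral [IsFiniteMeasure μ] {φ : S → Y → ℝ}
    (hφ : ∀ y, Measurable fun z => φ z y) (hc : ∀ᵐ z ∂μ, Continuous (φ z)) {y₀ : Y} {c : ℝ}
    (h : ENNReal.ofReal c < ∫⁻ z, ENNReal.ofReal (φ z y₀) ∂μ) :
    ∃ r > 0, ∃ (M : ℕ) (f : S → ℝ), Measurable f ∧ (∀ z, 0 ≤ f z) ∧ (∀ z, f z ≤ M) ∧
      c < ∫ z, f z ∂μ ∧ ∀ᵐ z ∂μ, ∀ y, dist y y₀ < r → 0 ≤ φ z y → f z ≤ φ z y := by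
  have : Nonempty Y := ⟨y₀⟩
  have hofReal : ∀ᵐ z ∂μ, Continuous fun y => ENNReal.ofReal (φ z y) :=
    hc.mono fun z hz => ENNReal.continuous_ofReal.comp hz
  have hmeas (y : Y) : Measurable fun z => ENNReal.ofReal (φ z y) := (hφ y).ennreal_ofReal
  obtain ⟨k, hk⟩ := exists_truncBallInf_lt_lintegral hmeas hofReal h
  have hle (z : S) : truncBallInf (fun y => ENNReal.ofReal (φ z y)) y₀ k ≤ k := min_le_left _ _
  have hmeas_inf := measurable_truncBallInf hmeas y₀ k
  refine ⟨1 / ((k : ℝ) + 1), Nat.one_div_pos_of_nat, k,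
    fun z => (truncBallInf (fun y => ENNReal.ofReal (φ z y)) y₀ k).toReal,
    hmeas_inf.ennreal_toReal, fun _ => ENNReal.toReal_nonneg, fun z => ?_, ?_, ?_⟩
  · simpa using ENNReal.toReal_mono (ENNReal.natCast_ne_top k) (hle z)
  · have hfin : ∫⁻ z, truncBallInf (fun y => ENNReal.ofReal (φ z y)) y₀ k ∂μ ≠ ∞ :=
      ((lintegral_mono hle).trans_lt (lintegral_const_lt_top (ENNReal.natCast_ne_top k))).ne
    rw [integral_toReal hmeas_inf.aemeasurable (ae_lt_top hmeas_inf hfin)]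
    rw [← ENNReal.ofReal_toReal hfin] at hk
    exact (ENNReal.ofReal_lt_ofReal_iff'.mp hk).1
  · filter_upwards [hofReal] with z hz y hy h0
    exact ENNReal.toReal_le_of_le_ofReal h0 (truncBallInf_le_of_dist_lt hz hy)

end BoundedMinorant

section Averages

lemma sum_Icc_one_eq_sum_range {M : Type*} [AddCommMonoid M] (a : ℕ → M) (n : ℕ) :
    ∑ t ∈ Finset.Icc 1 n, a t = ∑ j ∈ Finset.range n, a (j + 1) := by
  rw [Finset.range_eq_Ico, Finset.sum_Ico_add', zero_add, Finset.Ico_add_one_right_eq_Icc]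

lemma eventually_sum_Icc_le_of_tendsto_zero {e : ℕ → ℝ} (he : Tendsto e atTop (𝓝 0)) {c : ℝ}
    (hc : 0 < c) : ∀ᶠ n : ℕ in atTop, ∑ t ∈ Finset.Icc 1 n, e t ≤ c * n := by
  have hcesaro := ((tendsto_add_atTop_iff_nat 1).mpr he).cesaro
  filter_upwards [hcesaro.eventually_le_const hc, eventually_gt_atTop 0] with n hn hn0
  rwa [inv_mul_le_iff₀ (Nat.cast_pos.mpr hn0), mul_comm, ← sum_Icc_one_eq_sum_range] at hn

lemma eventually_sum_Icc_le {u v : ℕ → ℝ} {c c' : ℝ} (huv : u ≤ᶠ[atTop] v)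
    (hv : ∀ᶠ n : ℕ in atTop, ∑ t ∈ Finset.Icc 1 n, v t ≤ c * n) (hc : c < c') :
    ∀ᶠ n : ℕ in atTop, ∑ t ∈ Finset.Icc 1 n, u t ≤ c' * n := by
  have hexcess : Tendsto (fun t => max (u t - v t) 0) atTop (𝓝 0) :=
    tendsto_const_nhds.congr' (huv.mono fun t ht => (max_eq_right (sub_nonpos.mpr ht)).symm)
  filter_upwards [hv, eventually_sum_Icc_le_of_tendsto_zero hexcess (sub_pos.mpr hc)] with n hn hn'
  calc ∑ t ∈ Finset.Icc 1 n, u t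
      ≤ ∑ t ∈ Finset.Icc 1 n, (v t + max (u t - v t) 0) :=
        Finset.sum_le_sum fun t _ => sub_le_iff_le_add'.mp (le_max_left _ _)
    _ = ∑ t ∈ Finset.Icc 1 n, v t + ∑ t ∈ Finset.Icc 1 n, max (u t - v t) 0 :=
        Finset.sum_add_distrib
    _ ≤ c' * n := by linarith

variable {E : Type*} [MeasurableSpace E] {ν : Measure E} [IsProbabilityMeasure ν]

lemma ae_eventually_sum_seqShift_le {f : (ℤ → E) → ℝ} (hfm : Measurable f)
    (hf : Integrable f (iidLaw ν)) {c : ℝ} (hc : ∫ z, f z ∂(iidLaw ν) < c) :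
    ∀ᵐ z ∂(iidLaw ν), ∀ᶠ n : ℕ in atTop,
      ∑ t ∈ Finset.Icc 1 n, f (seqShift (t : ℤ) z) ≤ c * n := by
  have hbirkhoff := ae_eventually_birkhoffSum_le (ergodic_seqShift (ν := ν) one_ne_zero) hfm hf hc
  filter_upwards [ae_forall_seqShift hbirkhoff] with z hz
  filter_upwards [hz 1] with n hn
  have hshift (j : ℕ) : seqShift (j * 1) (seqShift 1 z) = seqShift ((j + 1 : ℕ) : ℤ) z := by
    funext k
    simp only [seqShift]
    congr 1
    push_cast
    ring
  rw [sum_Icc_one_eq_sum_range]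
  simpa only [birkhoffSum, seqShift_iterate, hshift] using hn

end Averages

section Argmax

variable {S Y : Type*} [MeasurableSpace S] {μ : Measure S}

lemma ae_eventually_forall_mem_of_isCompact [TopologicalSpace Y] {C : Set Y} (hC : IsCompact C)
    {p : S → ℕ → Y → Prop} (hloc : ∀ y ∈ C, ∃ U ∈ 𝓝[C] y,
      ∀ᵐ z ∂μ, ∀ᶠ n in atTop, ∀ w ∈ U, p z n w) :
    ∀ᵐ z ∂μ, ∀ᶠ n in atTop, ∀ y ∈ C, p z n y := by
  refine hC.induction_on (p := fun C => ∀ᵐ z ∂μ, ∀ᶠ n in atTop, ∀ y ∈ C, p z n y)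
    (by simp) (fun A B hAB hB => ?_) (fun A B hA hB => ?_) hloc
  · filter_upwards [hB] with z hz
    exact hz.mono fun n hn y hy => hn y (hAB hy)
  · filter_upwards [hA, hB] with z hzA hzB
    filter_upwards [hzA, hzB] with n hnA hnB y hy
    exact hy.elim (hnA y) (hnB y)

theorem ae_tendsto_of_isMaxOn [MetricSpace Y] {K : Set Y} (hK : IsCompact K)
    {ℓ : S → ℕ → Y → ℝ} {y₀ : Y} (hy₀ : y₀ ∈ K)
    (hloc : ∀ y ∈ K, y ≠ y₀ → ∃ r > 0, ∀ᵐ z ∂μ, ∀ᶠ n in atTop, ∀ w ∈ K, dist w y < r →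
      ℓ z n w < ℓ z n y₀) :
    ∀ᵐ z ∂μ, ∀ ϑ : ℕ → Y, (∀ᶠ n in atTop, ϑ n ∈ K ∧ IsMaxOn (ℓ z n) K (ϑ n)) →
      Tendsto ϑ atTop (𝓝 y₀) := by
  have haway (k : ℕ) : ∀ᵐ z ∂μ, ∀ᶠ n in atTop, ∀ y ∈ K \ Metric.ball y₀ (1 / (k + 1)),
      ℓ z n y < ℓ z n y₀ := by
    refine ae_eventually_forall_mem_of_isCompact (hK.diff Metric.isOpen_ball) fun y hy => ?_
    have hne : y ≠ y₀ := fun h => hy.2 (h ▸ Metric.mem_ball_self Nat.one_div_pos_of_nat)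
    obtain ⟨r, hr, hlt⟩ := hloc y hy.1 hne
    refine ⟨K ∩ Metric.ball y r, inter_mem (mem_of_superset self_mem_nhdsWithin Set.sdiff_subset)
      (mem_nhdsWithin_of_mem_nhds (Metric.ball_mem_nhds y hr)), ?_⟩
    filter_upwards [hlt] with z hz
    exact hz.mono fun n hn w hw => hn w hw.1 hw.2
  filter_upwards [ae_all_iff.mpr haway] with z hz ϑ hϑ
  refine Metric.nhds_basis_ball_inv_nat_succ.tendsto_right_iff.mpr fun k _ => ?_
  filter_upwards [hz k, hϑ] with n hn ⟨hmem, hmax⟩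
  by_contra hfar
  exact (hn (ϑ n) ⟨hmem, hfar⟩).not_ge (hmax hy₀)

end Argmax

section Consistency

lemma exists_pos_exp_add_add_lt {a c : ℝ} (hc : 1 + a < c) : ∃ η > 0, Real.exp η + a + η < c := by
  have hcont : Tendsto (fun η : ℝ => Real.exp η + a + η) (𝓝[>] 0) (𝓝 (Real.exp 0 + a + 0)) :=
    (by fun_prop : Continuous fun η : ℝ => Real.exp η + a + η).continuousWithinAt
  rw [Real.exp_zero, add_zero] at hcont
  exact (eventually_mem_nhdsWithin.and (hcont.eventually_lt_const hc)).exists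

lemma contrast_egarch_le {θ : Param} {z : ℤ → ℝ} {t : ℤ} {l η : ℝ}
    (hl : |l - logVol θ z t| ≤ η) :
    contrast (egarch θ z t) l ≤ Real.exp η * z t ^ 2 + logVol θ z t + η := by
  obtain ⟨hlower, hupper⟩ := abs_le.mp hl
  have hexp : Real.exp (logVol θ z t - l) ≤ Real.exp η := Real.exp_le_exp.mpr (by linarith)
  rw [contrast_egarch]
  linarith [mul_le_mul_of_nonneg_right hexp (sq_nonneg (z t))]

-- Replacing `l` by `l'` costs a term proportional to the contrast, which is unbounded; the cost is
-- controlled only because the minorant `f` is bounded.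
lemma le_contrast_of_abs_sub_le {x l l' f m M ε : ℝ} (hl : |l' - l| ≤ ε) (hm : m ≤ l)
    (hf₀ : 0 ≤ f) (hfM : f ≤ M) (hf : f ≤ contrast x l - m) :
    f + m - (M + 1) * ε ≤ contrast x l' := by
  have hε : 0 ≤ ε := (abs_nonneg _).trans hl
  obtain ⟨hlower, hupper⟩ := abs_le.mp hl
  have hscale : contrast x l' = x ^ 2 * Real.exp (-l) * Real.exp (l - l') + l' := by
    rw [contrast, mul_assoc, ← Real.exp_add]
    ring_nf
  have hnonneg : 0 ≤ x ^ 2 * Real.exp (-l) := by positivity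
  rw [contrast] at hf
  rw [hscale]
  rcases le_total ε 1 with hε1 | hε1
  · have hexp : 1 - ε ≤ Real.exp (l - l') := by linarith [Real.add_one_le_exp (l - l')]
    have hshrink := mul_le_mul_of_nonneg_right hf (sub_nonneg.mpr hε1)
    linarith [mul_le_mul_of_nonneg_left hexp hnonneg, mul_le_mul_of_nonneg_right hfM hε,
      mul_nonneg (sub_nonneg.mpr hm) hε]
  · linarith [mul_nonneg hnonneg (Real.exp_pos (l - l')).le,
      mul_le_mul_of_nonneg_left hε1 (hf₀.trans hfM)]

variable {ν : Measure ℝ} [IsProbabilityMeasure ν] (hvar : ∫ y, y ^ 2 ∂ν = 1)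
  (hν : Integrable id ν) {θ₀ θ₁ : Param} {K : Set Param} (hK : IsCompact K)
  (hKΘ : K ⊆ paramSpace) (hθ₀ : θ₀ ∈ K)
  (hlam : HasNegativeMean (iidLaw ν) fun z => extLog (lipSup K (egarch θ₀ z 0)))

include hvar hν hK hKΘ hθ₀ hlam

lemma ae_eventually_sum_contrast_le {c : ℝ} (hc : 1 + ∫ z, logVol θ₀ z 0 ∂(iidLaw ν) < c) (s : ℝ) :
    ∀ᵐ z ∂(iidLaw ν), ∀ᶠ n : ℕ in atTop, ∑ t ∈ Finset.Icc 1 n,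
      contrast (egarch θ₀ z t) (Real.log (hHat s (egarch θ₀ z) θ₀ t)) ≤ c * n := by
  obtain ⟨η, hη, hηc⟩ := exists_pos_exp_add_add_lt hc
  obtain ⟨c', hc', hc'c⟩ := exists_between hηc
  have hmeas := measurable_logVol θ₀ 0
  have hlogVol := integrable_logVol (hKΘ hθ₀) hν 0
  have hsq := (integrable_eval_sq hvar 0).const_mul (Real.exp η)
  have hsum : Integrable (fun z => Real.exp η * z 0 ^ 2 + logVol θ₀ z 0) (iidLaw ν) :=
    hsq.add hlogVol
  have hint : Integrable (fun z => Real.exp η * z 0 ^ 2 + logVol θ₀ z 0 + η) (iidLaw ν) :=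
    hsum.add (integrable_const η)
  have hvalue : ∫ z, (Real.exp η * z 0 ^ 2 + logVol θ₀ z 0 + η) ∂(iidLaw ν) =
      Real.exp η + ∫ z, logVol θ₀ z 0 ∂(iidLaw ν) + η := by
    rw [integral_add hsum (integrable_const η), integral_add hsq hlogVol, integral_const_mul,
      integral_eval_sq hvar]
    simp
  filter_upwards [ae_eventually_sum_seqShift_le (by fun_prop) hint (hvalue.trans_lt hc'),
    ae_isContractive hK hθ₀ hlam, ae_statLog_eq_logVol hK hKΘ hθ₀ hlam hν] with z hz hcz hstat
  obtain ⟨E, hE₀, hE⟩ := exists_abs_log_hHat_sub_statLog_le hK hKΘ hcz s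
  refine eventually_sum_Icc_le ?_ hz hc'c
  filter_upwards [hE₀.eventually_le_const hη] with t ht
  have hclose := (hE t θ₀ hθ₀).trans ht
  rw [hstat] at hclose
  simpa only [logVol_seqShift, seqShift, zero_add] using contrast_egarch_le hclose

variable (hmean : ∫ y, y ∂ν = 0) (hndeg : ∀ a b : ℝ, ¬ ∀ᵐ y ∂ν, y = a ∨ y = b)
  (hγδ : (θ₀.γ, θ₀.δ) ≠ (0, 0)) (hθ₁ : θ₁ ∈ K) (hne : θ₁ ≠ θ₀)

include hmean hndeg hγδ hθ₁ hne

lemma exists_bounded_minorant_statContrast :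
    ∃ r > 0, ∃ (M : ℕ) (f : (ℤ → ℝ) → ℝ), Measurable f ∧ (∀ z, 0 ≤ f z) ∧ (∀ z, f z ≤ M) ∧
      1 + ∫ z, logVol θ₀ z 0 ∂(iidLaw ν) - lowerBound K < ∫ z, f z ∂(iidLaw ν) ∧
      ∀ᵐ z ∂(iidLaw ν), ∀ θ ∈ K, dist θ θ₁ < r → ∀ t,
        f (seqShift t z) ≤ statContrast (egarch θ₀ z) θ t - lowerBound K := by
  have hcontr := ae_isContractive hK hθ₀ hlam
  have hcont : ∀ᵐ z ∂(iidLaw ν),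
      Continuous fun θ : K => statContrast (egarch θ₀ z) θ 0 - lowerBound K :=
    hcontr.mono fun z hz => (continuousOn_statContrast hK hKΘ hz 0).domRestrict.sub continuous_const
  obtain ⟨r, hr, M, f, hf, hf₀, hfM, hlt, hle⟩ := exists_bounded_minorant_lt_integral
    (φ := fun z (θ : K) => statContrast (egarch θ₀ z) θ 0 - lowerBound K) (y₀ := ⟨θ₁, hθ₁⟩)
    (fun θ => (measurable_statContrast_egarch θ₀ θ 0).sub_const (lowerBound K)) hcont
    (lt_lintegral_statContrast_sub_lowerBound hK hKΘ hvar hθ₀ hlam hν hmean hndeg hγδ hθ₁ hne)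
  refine ⟨r, hr, M, f, hf, hf₀, hfM, hlt, ?_⟩
  filter_upwards [ae_forall_seqShift hle, hcontr] with z hz hcz θ hθ hdist t
  have hstat : statContrast (egarch θ₀ (seqShift t z)) θ 0 = statContrast (egarch θ₀ z) θ t := by
    rw [statContrast_egarch_seqShift, zero_add]
  have hnonneg : 0 ≤ statContrast (egarch θ₀ z) θ t - lowerBound K := by
    have hsq : 0 ≤ egarch θ₀ z t ^ 2 * Real.exp (-statLog (egarch θ₀ z) θ t) := by positivity
    rw [statContrast, contrast]
    linarith [lowerBound_le_statLog hK hKΘ hcz hθ t]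
  rw [← hstat] at hnonneg ⊢
  exact hz t ⟨θ, hθ⟩ hdist hnonneg

lemma exists_ball_ae_eventually_le_sum_contrast (s : ℝ) :
    ∃ r > 0, ∃ c > 1 + ∫ z, logVol θ₀ z 0 ∂(iidLaw ν), ∀ᵐ z ∂(iidLaw ν), ∀ᶠ n : ℕ in atTop,
      ∀ θ ∈ K, dist θ θ₁ < r → c * n ≤ ∑ t ∈ Finset.Icc 1 n,
        contrast (egarch θ₀ z t) (Real.log (hHat s (egarch θ₀ z) θ t)) := by
  obtain ⟨r, hr, M, f, hf, hf₀, hfM, hlt, hle⟩ := exists_bounded_minorant_statContrast hvar hν hK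
    hKΘ hθ₀ hlam hmean hndeg hγδ hθ₁ hne
  obtain ⟨c', hc', hc'f⟩ := exists_between hlt
  obtain ⟨c, hc, hcc'⟩ := exists_between hc'
  have hint : Integrable f (iidLaw ν) := .of_bound hf.aestronglyMeasurable (M : ℝ)
    (ae_of_all _ fun z => (Real.norm_of_nonneg (hf₀ z)).trans_le (hfM z))
  have hneg : ∫ z, -f z ∂(iidLaw ν) < -c' := by
    rw [integral_neg]
    exact neg_lt_neg hc'f
  refine ⟨r, hr, c + lowerBound K, sub_lt_iff_lt_add.mp hc, ?_⟩
  filter_upwards [ae_eventually_sum_seqShift_le hf.neg hint.neg hneg, hle,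
    ae_isContractive hK hθ₀ hlam] with z hbirkhoff hfz hcz
  obtain ⟨E, hE₀, hE⟩ := exists_abs_log_hHat_sub_statLog_le hK hKΘ hcz s
  have herror : Tendsto (fun t => ((M : ℝ) + 1) * E t) atTop (𝓝 0) := by
    simpa using hE₀.const_mul ((M : ℝ) + 1)
  filter_upwards [hbirkhoff, eventually_sum_Icc_le_of_tendsto_zero herror (sub_pos.mpr hcc')]
    with n hn hEn θ hθ hdist
  have hterm : ∑ t ∈ Finset.Icc 1 n, (f (seqShift t z) + lowerBound K - (M + 1) * E t) ≤
      ∑ t ∈ Finset.Icc 1 n, contrast (egarch θ₀ z t) (Real.log (hHat s (egarch θ₀ z) θ t)) :=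
    Finset.sum_le_sum fun t _ => le_contrast_of_abs_sub_le (hE t θ hθ)
      (lowerBound_le_statLog hK hKΘ hcz hθ t) (hf₀ _) (hfM _) (hfz θ hθ hdist t)
  rw [Finset.sum_sub_distrib, Finset.sum_add_distrib, Finset.sum_const, Nat.card_Icc,
    add_tsub_cancel_right, nsmul_eq_mul] at hterm
  simp only [Pi.neg_apply, Finset.sum_neg_distrib] at hn
  linarith

variable {s : ℝ} (hs : 0 < s)

include hs

theorem exists_ball_ae_eventually_logLik_lt :
    ∃ r > 0, ∀ᵐ z ∂(iidLaw ν), ∀ᶠ n : ℕ in atTop, ∀ θ ∈ K, dist θ θ₁ < r →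
      logLik s (egarch θ₀ z) n θ < logLik s (egarch θ₀ z) n θ₀ := by
  obtain ⟨r, hr, c, hc, hlower⟩ := exists_ball_ae_eventually_le_sum_contrast hvar hν hK hKΘ hθ₀
    hlam hmean hndeg hγδ hθ₁ hne s
  obtain ⟨c', hc', hc'c⟩ := exists_between hc
  refine ⟨r, hr, ?_⟩
  filter_upwards [hlower, ae_eventually_sum_contrast_le hvar hν hK hKΘ hθ₀ hlam hc' s]
    with z hzlower hzupper
  filter_upwards [hzlower, hzupper, eventually_gt_atTop 0] with n hnlower hnupper hn θ hθ hdist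
  have hgap : c' * n < c * n := mul_lt_mul_of_pos_right hc'c (Nat.cast_pos.mpr hn)
  rw [logLik_eq_sum_contrast hs, logLik_eq_sum_contrast hs]
  linarith [hnlower θ hθ hdist]

omit hθ₁ hne in
theorem ae_tendsto_of_isQMLE : ∀ᵐ z ∂(iidLaw ν), ∀ ϑ : ℕ → Param,
    (∀ n, 1 ≤ n → IsQMLE s (egarch θ₀ z) K n (ϑ n)) → Tendsto ϑ atTop (𝓝 θ₀) := by
  have hargmax := ae_tendsto_of_isMaxOn hK hθ₀ fun θ hθ hne =>
    exists_ball_ae_eventually_logLik_lt hvar hν hK hKΘ hθ₀ hlam hmean hndeg hγδ hθ hne hs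
  filter_upwards [hargmax] with z hz ϑ hϑ
  exact hz ϑ ((eventually_ge_atTop 1).mono hϑ)

end Consistency

section NegativeMean

variable {Ω Ω' : Type*} [MeasurableSpace Ω] [MeasurableSpace Ω'] {P : Measure Ω}

lemma hasNegativeMean_map_iff {g : Ω → Ω'} (hg : Measurable g) {f : Ω' → EReal}
    (hf : Measurable f) : HasNegativeMean (P.map g) f ↔ HasNegativeMean P fun ω => f (g ω) := by
  rw [HasNegativeMean, HasNegativeMean, lintegral_map (by fun_prop) hg,
    lintegral_map (by fun_prop) hg]

lemma hasNegativeMean_congr_ae {f g : Ω → EReal} (h : f =ᵐ[P] g) :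
    HasNegativeMean P f ↔ HasNegativeMean P g := by
  have hpos : ∫⁻ ω, (f ω).toENNReal ∂P = ∫⁻ ω, (g ω).toENNReal ∂P :=
    lintegral_congr_ae (h.fun_comp EReal.toENNReal)
  have hneg : ∫⁻ ω, (-f ω).toENNReal ∂P = ∫⁻ ω, (-g ω).toENNReal ∂P :=
    lintegral_congr_ae (h.fun_comp fun y => (-y).toENNReal)
  rw [HasNegativeMean, HasNegativeMean, hpos, hneg]

end NegativeMean

namespace IsStationaryEGARCH

variable {Ω : Type*} [MeasurableSpace Ω] {P : Measure Ω} {θ : Param} {Z X σ : ℤ → Ω → ℝ}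
  (h : IsStationaryEGARCH P θ Z X σ)

include h

lemma integral_id_map : ∫ y, y ∂(P.map (Z 0)) = 0 :=
  (integral_map (h.measurable_Z 0).aemeasurable (by fun_prop)).trans h.mean

lemma integral_sq_map : ∫ y, y ^ 2 ∂(P.map (Z 0)) = 1 :=
  (integral_map (h.measurable_Z 0).aemeasurable (by fun_prop)).trans h.variance

variable [IsProbabilityMeasure P]

lemma not_ae_map_eq_or_eq (hZ : ∀ a b : ℝ, P {ω | Z 0 ω = a ∨ Z 0 ω = b} ≠ 1) (a b : ℝ) :
    ¬ ∀ᵐ y ∂(P.map (Z 0)), y = a ∨ y = b := fun hab =>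
  hZ a b ((measure_congr (ae_eq_univ.mpr (ae_of_ae_map (h.measurable_Z 0).aemeasurable hab))).trans
    measure_univ)

lemma hasNegativeMean_iidLaw (hθ : θ ∈ paramSpace) {K : Set Param} (hK : IsCompact K)
    (hne : K.Nonempty)
    (hlam : HasNegativeMean P fun ω => extLog (supNorm K (lipBound K (X 0 ω)))) :
    HasNegativeMean (iidLaw (P.map (Z 0))) fun z => extLog (lipSup K (egarch θ z 0)) := by
  have hmeas : Measurable fun z => extLog (lipSup K (egarch θ z 0)) :=
    ENNReal.measurable_log.comp
      ((measurable_lipSup hK hne).comp (measurable_egarch θ 0)).ennreal_ofReal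
  rw [← h.map_innovations_eq_iidLaw, hasNegativeMean_map_iff h.measurable_innovations hmeas]
  refine (hasNegativeMean_congr_ae ?_).mp hlam
  filter_upwards [h.ae_eq_egarch hθ] with ω hω
  rw [lipSup, ← congrFun hω 0]

end IsStationaryEGARCH

end EGARCH

theorem theorem5p1 {Ω : Type*} [MeasurableSpace Ω] (P : Measure Ω) [IsProbabilityMeasure P]
    (Z X σ : ℤ → Ω → ℝ) (θ₀ : EGARCH.Param)
    -- a stationary EGARCH process with `0 ≤ β₀ < 1`, `δ₀ ≥ |γ₀|`, `(γ₀, δ₀) ≠ (0, 0)`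
    (hXσ : EGARCH.IsStationaryEGARCH P θ₀ Z X σ)
    (hβ₀ : 0 ≤ θ₀.β ∧ θ₀.β < 1) (hδ₀ : |θ₀.γ| ≤ θ₀.δ) (hγδ : (θ₀.γ, θ₀.δ) ≠ (0, 0))
    -- the law of `Z_0` is not concentrated at two points
    (hZ : ∀ a b : ℝ, P {ω | Z 0 ω = a ∨ Z 0 ω = b} ≠ 1)
    (K : Set EGARCH.Param) (hK : IsCompact K) (hKΘ : K ⊆ EGARCH.paramSpace) (hθ₀ : θ₀ ∈ K)
    -- `E log ‖λ₀‖_K < 0`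
    (hlam : EGARCH.HasNegativeMean P fun ω =>
      EGARCH.extLog (EGARCH.supNorm K (EGARCH.lipBound K (X 0 ω))))
    -- the initial value of the recursion for the volatility estimate
    (s : ℝ) (hs : 0 < s) :
    (∀ (n : ℕ) (ω : Ω), ∃ θ, EGARCH.IsQMLE s (fun t => X t ω) K n θ) ∧
    ∀ θhat : ℕ → Ω → EGARCH.Param,
      (∀ n, 1 ≤ n → ∀ᵐ ω ∂P, EGARCH.IsQMLE s (fun t => X t ω) K n (θhat n ω)) →
      ∀ᵐ ω ∂P, Tendsto (fun n => θhat n ω) atTop (𝓝 θ₀) := by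
  refine ⟨fun n ω => EGARCH.exists_isQMLE hK ⟨θ₀, hθ₀⟩ hs _ n, fun θhat hθhat => ?_⟩
  have := hXσ.isProbabilityMeasure_map
  have hconsistent := EGARCH.ae_tendsto_of_isQMLE hXσ.integral_sq_map
    (hXσ.memLp_id_map.integrable one_le_two) hK hKΘ hθ₀
    (hXσ.hasNegativeMean_iidLaw (hKΘ hθ₀) hK ⟨θ₀, hθ₀⟩ hlam) hXσ.integral_id_map
    (hXσ.not_ae_map_eq_or_eq hZ) hγδ hs
  filter_upwards [hXσ.ae_innovations_of_ae_iidLaw hconsistent, hXσ.ae_eq_egarch (hKΘ hθ₀),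
    ae_all_iff.mpr fun n => ae_all_iff.mpr (hθhat n)] with ω hω hX hmax
  exact hω (fun n => θhat n ω) fun n hn => hX ▸ hmax n hn
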